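/- **Colour Refinement.** Let $G$ be a finite simple graph. Let $\chi^0$ be constant on $V(G)$ and, for $i\ge 0$, let $\chi^{i+1}(v)=\big(\chi^{i}(v),\{\!\{\chi^{i}(w) : w\in N(v)\}\!\}\big)$, where $\{\!\{\cdot\}\!\}$ denotes a multiset. Let $\pi^i$ be the partition of $V(G)$ into the colour classes of $\chi^i$. The number of Colour Refinement iterations on $G$ is the least $j\ge 0$ with $\pi^j=\pi^{j+1}$; $G$ is a *long-refinement graph* if this number equals $|V(G)|-1$. **Encoding.** A string $\Xi=\Xi(1)\cdots\Xi(\ell)$ over the alphabet $\{0,1,\mathrm S,\mathrm X\}$ is *admissible* if $\ell\ge 3$, $\Xi(1)=\mathrm S$, and $\mathrm X$ occurs in $\Xi$ exactly twice, say at the positions $r<r'$. For such $\Xi$, the graph $G(\Xi)$ has the $2\ell$ vertices $v_{i,j}$ ($1\le i\le \ell$, $j\in\{1,2\}$) and the edge set $$\begin{aligned}E(G(\Xi))={}&\{\{v_{i,1},v_{i,2}\} : 1\le i\le \ell,\ \Xi(i)=1 \text{ or } i=\ell\}\cup\{\{v_{i,j},v_{i+1,j}\} : 1\le i<\ell,\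 j\in\{1,2\}\}\\&\cup\{\{v_{r,j},v_{1,1}\} : j\in\{1,2\}\}\cup\{\{v_{r',j},v_{1,2}\} : j\in\{1,2\}\}.\end{aligned}$$ **Theorem.** Let $\Xi$ be the string $\mathrm{S011XX}$ or one of the following strings, where $k\ge 0$ is an integer and $w^k$ denotes the $k$-fold repetition of the word $w$: 1. $\mathrm S\,1^k\,00\,1^k\,\mathrm{X1X}\,1^k\,0$; 2. $\mathrm S\,1^k\,1100\,1^k\,\mathrm{XX}\,1^k\,0$; 3. $\mathrm S\,1^k\,001\,1^k\,\mathrm{XX}\,1^k\,10$; 4. $\mathrm S\,011\,(011)^k\,00\,(110)^k\,\mathrm{XX}\,(011)^k\,0$; 5. $\mathrm S\,(011)^k\,00\,(110)^k\,\mathrm{1X0X1}\,(011)^k\,0$. Then $\Xi$ is admissible, the set of vertex degrees of $G(\Xi)$ is $\{2,3\}$, and $G(\Xi)$ is a long-refinement graph. -/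

import Mathlib

namespace ColourRefinement

section Refinement

universe u v

/-- The set of colours available after `i` iterations of Colour Refinement, when the initial
colours are taken from `C`: a colour after `i + 1` iterations is a pair consisting of an old colour
and a multiset of old colours. -/
def Colour (C : Type v) : ℕ → Type v
  | 0 => C
  | i + 1 => Colour C i × Multiset (Colour C i)

variable {V : Type u} [Fintype V] {C : Type v}

/-- The colouring `χ^i` computed by Colour Refinement after `i` iterations on the graph `G` with
initial colouring `c`: `χ^0 = c`, and `χ^(i+1)(v)` is the pair of `χ^i(v)` and the multiset of the
colours `χ^i(w)` over the neighbours `w` of `v`. -/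
def refine (G : SimpleGraph V) [DecidableRel G.Adj] (c : V → C) : (i : ℕ) → V → Colour C i
  | 0 => c
  | i + 1 => fun v => (refine G c i v, (G.neighborFinset v).val.map (refine G c i))

/-- The partition `π^i` of the vertex set into the colour classes of `χ^i`, when Colour Refinement
is run on the uncoloured (that is, monochromatic) graph `G`. -/
def partition (G : SimpleGraph V) [DecidableRel G.Adj] (i : ℕ) : Setoid V :=
  Setoid.ker (refine G (fun _ => ()) i)

/-- The number of iterations of Colour Refinement on the uncoloured graph `G`: the least `j` with
`π^j = π^(j+1)`. Such a `j` always exists, see `exists_partition_eq_succ`. -/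
noncomputable def iterationNumber (G : SimpleGraph V) [DecidableRel G.Adj] : ℕ :=
  sInf {j : ℕ | partition G j = partition G (j + 1)}

/-- `G` is a long-refinement graph: Colour Refinement takes `|G| - 1` iterations on `G`. -/
def IsLongRefinement (G : SimpleGraph V) [DecidableRel G.Adj] : Prop :=
  iterationNumber G + 1 = Fintype.card V

theorem partition_succ_le (G : SimpleGraph V) [DecidableRel G.Adj] (i : ℕ) :
    partition G (i + 1) ≤ partition G i := by
  intro v w h
  exact congrArg Prod.fst h

theorem exists_partition_eq_succ (G : SimpleGraph V) [DecidableRel G.Adj] :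
    ∃ j : ℕ, partition G j = partition G (j + 1) := by
  by_contra! h
  have hanti : StrictAnti (partition G) :=
    strictAnti_nat_of_succ_lt fun i => lt_of_le_of_ne (partition_succ_le G i) (h i).symm
  have : Finite (Setoid V) :=
    Finite.of_injective (fun s : Setoid V => fun a b => s a b)
      (fun s t hst => Setoid.ext fun a b => iff_of_eq (congrFun (congrFun hst a) b))
  exact not_injective_infinite_finite _ hanti.injective

end Refinement

section Strings

/-- The alphabet `{0, 1, S, X}`. -/
inductive Letter : Type
  | zero
  | one
  | S
  | X
  deriving DecidableEq

open Letter

/-- `Ξ` is an admissible string: its length is at least `3`, its first letter is `S`, and exactly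
two of its letters are `X`. -/
def IsAdmissible (Ξ : List Letter) : Prop :=
  3 ≤ Ξ.length ∧ Ξ.head? = some S ∧ Ξ.count X = 2

/-- The edges of `G(Ξ)`, each listed in at least one direction. Positions are counted from `0`, and
the vertex `(i, j)` is the `j`-th vertex (`j = 0, 1`) of the pair at position `i`. -/
def EncodedEdge (Ξ : List Letter) (p q : Fin Ξ.length × Fin 2) : Prop :=
  -- the two vertices of a pair of type `1`, and the two vertices of the last pair, are adjacent
  (p.1 = q.1 ∧ p.2 ≠ q.2 ∧ (Ξ[p.1] = one ∨ p.1.val + 1 = Ξ.length)) ∨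
  -- successive pairs are joined by a matching
  (p.1.val + 1 = q.1.val ∧ p.2 = q.2) ∨
  -- both vertices of the first pair of type `X` are adjacent to the first vertex of the first pair
  (Ξ[p.1] = X ∧ (∀ i, i < p.1 → Ξ[i] ≠ X) ∧ q.1.val = 0 ∧ q.2 = 0) ∨
  -- both vertices of the second pair of type `X` are adjacent to the second vertex of the first pair
  (Ξ[p.1] = X ∧ (∃ i, i < p.1 ∧ Ξ[i] = X) ∧ q.1.val = 0 ∧ q.2 = 1)

instance (Ξ : List Letter) : DecidableRel (EncodedEdge Ξ) := fun p q => by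
  unfold EncodedEdge
  infer_instance

/-- The graph `G(Ξ)` encoded by an (admissible) string `Ξ`. -/
def encodedGraph (Ξ : List Letter) : SimpleGraph (Fin Ξ.length × Fin 2) :=
  SimpleGraph.fromRel (EncodedEdge Ξ)

instance (Ξ : List Letter) : DecidableRel (encodedGraph Ξ).Adj := fun p q => by
  unfold encodedGraph
  infer_instance

/-- The `k`-fold repetition of a word. -/
def rep (w : List Letter) (k : ℕ) : List Letter := (List.replicate k w).flatten

/-- `S 1^k 00 1^k X1X 1^k 0` -/
def family1 (k : ℕ) : List Letter :=
  [S] ++ rep [one] k ++ [zero, zero] ++ rep [one] k ++ [X, one, X] ++ rep [one] k ++ [zero]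

/-- `S 1^k 1100 1^k XX 1^k 0` -/
def family2 (k : ℕ) : List Letter :=
  [S] ++ rep [one] k ++ [one, one, zero, zero] ++ rep [one] k ++ [X, X] ++ rep [one] k ++ [zero]

/-- `S 1^k 001 1^k XX 1^k 10` -/
def family3 (k : ℕ) : List Letter :=
  [S] ++ rep [one] k ++ [zero, zero, one] ++ rep [one] k ++ [X, X] ++ rep [one] k ++ [one, zero]

/-- `S 011 (011)^k 00 (110)^k XX (011)^k 0` -/
def family4 (k : ℕ) : List Letter :=
  [S] ++ [zero, one, one] ++ rep [zero, one, one] k ++ [zero, zero] ++ rep [one, one, zero] k ++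
    [X, X] ++ rep [zero, one, one] k ++ [zero]

/-- `S (011)^k 00 (110)^k 1X0X1 (011)^k 0` -/
def family5 (k : ℕ) : List Letter :=
  [S] ++ rep [zero, one, one] k ++ [zero, zero] ++ rep [one, one, zero] k ++
    [one, X, zero, X, one] ++ rep [zero, one, one] k ++ [zero]

/-- The single string `S011XX` together with the five infinite families. -/
def longRefinementStrings : Set (List Letter) :=
  {[S, zero, one, one, X, X]} ∪ Set.range family1 ∪ Set.range family2 ∪ Set.range family3 ∪
    Set.range family4 ∪ Set.range family5

end Strings

end ColourRefinement

/-! A string of length `ℓ` gives `2ℓ` vertices, so `2ℓ - 1` rounds are needed. Refinement spends `ℓ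
- 1` rounds on reaching the partition into the `ℓ` pairs, and then `ℓ` rounds on splitting the pairs
one at a time.

Apart from the edges at the letters X, the graph is symmetric under swapping the two vertices of
every pair. As long as the positions `r` and `r'` of X have the same colour, this asymmetry is
invisible and colours depend on the position only. Once the pairs are the classes, the first pair
splits, since one of its vertices sees pair `r` and the other pair `r'`; the split then travels
along the matching, one pair per round (`Layout.partition_add_of_eq_pairs`).

For the first `ℓ - 1` rounds, fold the path of positions into three layers. The fold `f` is the
distance to the end of the layer, so its zeros are the two middle letters 00 and the last pair. The
strings are built so that positions with the same value of `f` have matching neighbourhoods for as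
long as necessary. Refinement first separates the values of `f` in increasing order
(`Layout.partition_eq_fold`). Only when the largest values are told apart does an asymmetry appear
near the start of the string; it then runs along the path and separates the layers position by
position, up to `r` (`Layout.partition_eq_pairs`). In the families built from the word 011 there is
an extra initial round that separates degree 2 from degree 3, that is, values divisible by 3 from
the others.

All phases are instances of `partition_chain`: a coarse colouring `a` together with a value `e`
whose levels are peeled off one per round. `Layout.isLongRefinement_of_fold` combines them, and each
family is then checked against a table of folded neighbourhoods. -/

namespace ColourRefinement

/-! ### Refinement that peels off one value per round -/

section Chains

universe u v

/-- The function `g` factors through `f`, so the factor can be applied to both multisets. -/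
theorem map_eq_map_of_ker_le {V : Type*} {α β : Type*} {f : V → α} {g : V → β}
    (h : ∀ v w, f v = f w → g v = g w) {s t : Multiset V} (hst : s.map f = t.map f) :
    s.map g = t.map g := by
  rcases s.empty_or_exists_mem with rfl | ⟨v, -⟩
  · rw [Multiset.map_zero, eq_comm, Multiset.map_eq_zero] at hst
    rw [hst]
  · have : Nonempty β := ⟨g v⟩
    obtain ⟨k, rfl⟩ := (Function.factorsThrough_iff (f := f) g).1 fun {a b} hab => h a b hab
    rw [← Multiset.map_map, hst, Multiset.map_map]

variable {V : Type u} [Fintype V] (G : SimpleGraph V) [DecidableRel G.Adj]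

theorem refine_succ_eq_iff {t : ℕ} {v w : V} :
    refine G (fun _ => ()) (t + 1) v = refine G (fun _ => ()) (t + 1) w ↔
      refine G (fun _ => ()) t v = refine G (fun _ => ()) t w ∧
        (G.neighborFinset v).val.map (refine G (fun _ => ()) t) =
          (G.neighborFinset w).val.map (refine G (fun _ => ()) t) :=
  Prod.ext_iff

theorem partition_rel {t : ℕ} {v w : V} :
    partition G t v w ↔ refine G (fun _ => ()) t v = refine G (fun _ => ()) t w := Iff.rfl

variable {G}

/-- A round depends only on the kernel of the current colouring, so the nested colours can be
replaced by any convenient `g` with the same kernel. -/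
theorem partition_succ_rel {α : Type*} {g : V → α} {t : ℕ} (h : partition G t = Setoid.ker g)
    (v w : V) :
    partition G (t + 1) v w ↔ g v = g w ∧
      (G.neighborFinset v).val.map g = (G.neighborFinset w).val.map g := by
  have hk : ∀ v w, refine G (fun _ => ()) t v = refine G (fun _ => ()) t w ↔ g v = g w :=
    fun v w => Setoid.ext_iff.1 h v w
  rw [partition_rel, refine_succ_eq_iff, hk]
  exact and_congr_right fun _ => ⟨map_eq_map_of_ker_le fun v w => (hk v w).1,
    map_eq_map_of_ker_le fun v w => (hk v w).2⟩

theorem partition_succ_congr {s t : ℕ} (h : partition G s = partition G t) :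
    partition G (s + 1) = partition G (t + 1) := by
  ext v w
  exact (partition_succ_rel h v w).trans
    (partition_succ_rel (g := refine G (fun _ => ()) t) rfl v w).symm

theorem partition_zero : partition G 0 = ⊤ := by
  ext v w
  exact iff_of_true rfl trivial

theorem partition_one : partition G 1 = Setoid.ker fun v => G.degree v := by
  ext v w
  rw [partition_succ_rel (g := fun _ => ()) rfl, Multiset.map_const',
    Multiset.map_const', Setoid.ker_def]
  refine (and_iff_right rfl).trans ⟨fun h => ?_, fun h => congrArg (Multiset.replicate · ()) h⟩
  simpa using congrArg Multiset.card h

theorem iterationNumber_eq {n : ℕ} (h : partition G (n + 1) = ⊥) (h' : partition G n ≠ ⊥) :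
    iterationNumber G = n + 1 := by
  have stable : ∀ j, partition G j = partition G (j + 1) →
      ∀ i, partition G (j + i) = partition G j := by
    intro j hj i
    induction i with
    | zero => rfl
    | succ i ih => rw [← Nat.add_assoc, partition_succ_congr ih, ← hj]
  have hanti : Antitone (partition G) := antitone_nat_of_succ_le (partition_succ_le G)
  refine le_antisymm (Nat.sInf_le ?_) (le_csInf ⟨n + 1, ?_⟩ ?_)
  · exact h.trans (le_bot_iff.1 (h ▸ partition_succ_le G (n + 1))).symm
  · exact h.trans (le_bot_iff.1 (h ▸ partition_succ_le G (n + 1))).symm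
  · intro j hj
    by_contra! hlt
    have hjn : j ≤ n := by omega
    -- A stable round `j ≤ n` would freeze the partition, so it would be discrete at round `n`
    -- already.
    obtain ⟨i, rfl⟩ := Nat.exists_eq_add_of_le hjn
    exact h' ((stable j hj i).trans ((stable j hj (i + 1)).symm.trans h))

/-- If `a` and `e` colour the vertices such that in each round `s` exactly the vertices with
`e`-value `s` are separated from those vertices of the same `a`-colour that have a larger `e`-value,
then Colour Refinement follows the values of `e` one at a time. -/
theorem partition_chain {α : Type*} (a : V → α) (e : V → ℕ) {t s₀ : ℕ} (n : ℕ)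
    (h₀ : partition G t = Setoid.ker fun v => (a v, min (e v) s₀))
    (hsame : ∀ s v w, s₀ ≤ s → s < s₀ + n → a v = a w → (e v = e w ∨ s < e v ∧ s < e w) →
      (G.neighborFinset v).val.map (fun u => (a u, min (e u) s)) =
        (G.neighborFinset w).val.map (fun u => (a u, min (e u) s)))
    (hdiff : ∀ v w, s₀ ≤ e v → e v < s₀ + n → a v = a w → e v < e w →
      (G.neighborFinset v).val.map (fun u => (a u, min (e u) (e v))) ≠
        (G.neighborFinset w).val.map (fun u => (a u, min (e u) (e v)))) :
    partition G (t + n) = Setoid.ker fun v => (a v, min (e v) (s₀ + n)) := by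
  induction n with
  | zero => exact h₀
  | succ n ih =>
    have ih := ih (fun s v w h1 h2 => hsame s v w h1 (by omega))
      (fun v w h1 h2 => hdiff v w h1 (by omega))
    ext v w
    rw [← Nat.add_assoc, partition_succ_rel ih, Setoid.ker_def, Prod.mk.injEq, Prod.mk.injEq]
    constructor
    · rintro ⟨⟨ha, hmin⟩, hm⟩
      refine ⟨ha, ?_⟩
      by_contra hne
      rcases lt_or_ge (e v) (e w) with hlt | hlt
      · have hv : s₀ + n = e v := by omega
        rw [hv] at hm
        exact hdiff v w (by omega) (by omega) ha hlt hm
      · have hw : s₀ + n = e w := by omega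
        rw [hw] at hm
        exact hdiff w v (by omega) (by omega) ha.symm (by omega) hm.symm
    · rintro ⟨ha, hmin⟩
      exact ⟨⟨ha, by omega⟩, hsame _ v w (by omega) (by omega) ha (by omega)⟩

end Chains

/-! ### Neighbourhoods in encoded graphs -/

section Layouts

open Letter

/-- The letters of `Ξ` that matter for `encodedGraph Ξ`: the letter `X` occurs exactly at the
positions `r < r'`, and the letter `1` exactly at the positions satisfying `L`. -/
structure Layout (Ξ : List Letter) (r r' : ℕ) (L : ℕ → Prop) : Prop where
  two_le : 2 ≤ r
  lt : r < r'
  lt_length : r' < Ξ.length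
  not_zero : ¬ L 0
  eq_X (i : ℕ) (h : i < Ξ.length) : Ξ[i] = X ↔ i = r ∨ i = r'
  eq_one (i : ℕ) (h : i < Ξ.length) : Ξ[i] = one ↔ L i

open scoped Classical in
/-- The neighbours of the vertex `(p, j)` of a graph encoded by a string of length `l` with a given
layout. -/
noncomputable def nbr (l r r' : ℕ) (L : ℕ → Prop) (p : ℕ) (j : Fin 2) : Multiset (ℕ × Fin 2) :=
  if p = 0 then {(1, j), (if j = 0 then r else r', 0), (if j = 0 then r else r', 1)}
  else {(p - 1, j)} + (if p + 1 < l then {(p + 1, j)} else 0) +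
    (if L p ∨ p + 1 = l then {(p, 1 - j)} else 0) +
    (if p = r then {(0, 0)} else 0) + (if p = r' then {(0, 1)} else 0)

namespace Layout

variable {Ξ : List Letter} {r r' : ℕ} {L : ℕ → Prop}

theorem encodedEdge_iff (h : Layout Ξ r r' L) (p q : Fin Ξ.length × Fin 2) :
    EncodedEdge Ξ p q ↔
      (p.1.val = q.1.val ∧ p.2 ≠ q.2 ∧ (L p.1 ∨ p.1.val + 1 = Ξ.length)) ∨
      (p.1.val + 1 = q.1.val ∧ p.2 = q.2) ∨ (p.1.val = r ∧ q.1.val = 0 ∧ q.2 = 0) ∨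
      (p.1.val = r' ∧ q.1.val = 0 ∧ q.2 = 1) := by
  have hX : ∀ i : Fin Ξ.length, Ξ[i] = X ↔ i.val = r ∨ i.val = r' := fun i => h.eq_X i i.2
  have h1 : ∀ i : Fin Ξ.length, Ξ[i] = one ↔ L i := fun i => h.eq_one i i.2
  have hr : r < Ξ.length := h.lt.trans h.lt_length
  have e1 : (Ξ[p.1] = X ∧ ∀ i, i < p.1 → Ξ[i] ≠ X) ↔ p.1.val = r := by
    simp only [ne_eq, hX]
    constructor
    · rintro ⟨h1 | h1, h2⟩
      · exact h1
      · exact absurd (Or.inl rfl) (h2 ⟨r, hr⟩ (Fin.lt_def.2 (h1 ▸ h.lt)))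
    · intro h1
      refine ⟨Or.inl h1, fun i hi => ?_⟩
      have := h.lt
      have := Fin.lt_def.1 hi
      omega
  have e2 : (Ξ[p.1] = X ∧ ∃ i, i < p.1 ∧ Ξ[i] = X) ↔ p.1.val = r' := by
    simp only [hX]
    constructor
    · rintro ⟨h1 | h1, i, hi, h2⟩
      · have := h.lt
        have := Fin.lt_def.1 hi
        omega
      · exact h1
    · intro h1
      exact ⟨Or.inr h1, ⟨r, hr⟩, Fin.lt_def.2 (h1 ▸ h.lt), Or.inl rfl⟩
  unfold EncodedEdge
  rw [← and_assoc (a := Ξ[p.1] = X), ← and_assoc (a := Ξ[p.1] = X), e1, e2, h1, Fin.ext_iff]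

theorem nodup_nbr (h : Layout Ξ r r' L) (p : ℕ) (j : Fin 2) :
    (nbr Ξ.length r r' L p j).Nodup := by
  have h2 := h.two_le
  have hlt := h.lt
  unfold nbr
  split_ifs <;> fin_cases j <;> simp <;> omega

theorem mem_nbr_iff (h : Layout Ξ r r' L) (v w : Fin Ξ.length × Fin 2) :
    (w.1.val, w.2) ∈ nbr Ξ.length r r' L v.1 v.2 ↔ (encodedGraph Ξ).Adj v w := by
  have h2 := h.two_le
  have hlt := h.lt
  have hl := h.lt_length
  have h0 := h.not_zero
  obtain ⟨⟨p, hp⟩, j⟩ := v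
  obtain ⟨⟨q, hq⟩, j'⟩ := w
  rw [encodedGraph, SimpleGraph.fromRel_adj, h.encodedEdge_iff, h.encodedEdge_iff]
  unfold nbr
  have hite : ∀ (P : Prop) [Decidable P] (x y : ℕ × Fin 2),
      x ∈ (if P then ({y} : Multiset (ℕ × Fin 2)) else 0) ↔ P ∧ x = y := by
    intro P _ x y
    split_ifs with hP <;> simp [hP]
  by_cases hp0 : p = 0
  · subst hp0
    simp only [if_true, Multiset.insert_eq_cons, Multiset.mem_cons, Multiset.mem_singleton,
      Prod.mk.injEq, ne_eq, Fin.ext_iff]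
    fin_cases j <;> fin_cases j' <;> simp <;> grind
  · simp only [if_neg hp0, Multiset.mem_add, hite, Multiset.mem_singleton, Prod.mk.injEq, ne_eq,
      Fin.ext_iff]
    fin_cases j <;> fin_cases j' <;> simp <;> grind

theorem map_neighborFinset (h : Layout Ξ r r' L) (v : Fin Ξ.length × Fin 2) :
    ((encodedGraph Ξ).neighborFinset v).val.map (fun u => (u.1.val, u.2)) =
      nbr Ξ.length r r' L v.1 v.2 := by
  have h2 := h.two_le
  have hlt := h.lt
  have hl := h.lt_length
  have hinj : Function.Injective fun u : Fin Ξ.length × Fin 2 => (u.1.val, u.2) := by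
    rintro ⟨a, b⟩ ⟨c, d⟩ hab
    simpa [Fin.ext_iff] using hab
  refine (Multiset.Nodup.ext (Multiset.Nodup.map hinj (Finset.nodup _)) (h.nodup_nbr _ _)).2 ?_
  rintro ⟨q, j⟩
  by_cases hq : q < Ξ.length
  · rw [h.mem_nbr_iff v (⟨q, hq⟩, j), ← SimpleGraph.mem_neighborFinset, Multiset.mem_map]
    exact ⟨fun ⟨u, hu, huq⟩ => hinj (a₁ := u) (a₂ := (⟨q, hq⟩, j)) huq ▸ hu,
      fun hu => ⟨_, hu, rfl⟩⟩
  · have hv := v.1.2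
    refine iff_of_false ?_ ?_
    · rw [Multiset.mem_map]
      rintro ⟨u, -, huq⟩
      have hu : u.1.val = q := (Prod.ext_iff.1 huq).1
      exact hq (hu ▸ u.1.2)
    · unfold nbr
      split_ifs <;> simp <;> omega

end Layout

end Layouts

/-! ### Degrees, and the final phase that splits the pairs -/

section Phases

open Letter

open scoped Classical in
/-- The positions of the neighbours of a vertex at a position `p ≠ 0`, except for those at
position `0` due to the letter `X`. -/
noncomputable def armNbr (l : ℕ) (L : ℕ → Prop) (p : ℕ) : Multiset ℕ :=
  {p - 1} + (if p + 1 < l then {p + 1} else 0) + (if L p ∨ p + 1 = l then {p} else 0)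

/-- The positions of the neighbours of a vertex at position `p`, if the positions `r` and `r'` of
the letter `X` are identified. -/
noncomputable def posNbr (l r r' : ℕ) (L : ℕ → Prop) (p : ℕ) : Multiset ℕ :=
  if p = 0 then {1, r, r} else armNbr l L p + (if p = r ∨ p = r' then {0} else 0)

theorem map_ite_zero {α β : Type*} (P : Prop) [Decidable P] (s : Multiset α) (g : α → β) :
    (if P then s else 0).map g = if P then s.map g else 0 := by
  split_ifs <;> rfl

/-- The two vertices of a pair differ only through the X edges at position 0, and a colouring with
`g r = g r'` cannot see this. -/
theorem map_nbr_eq_map_posNbr {α : Type*} {l r r' : ℕ} {L : ℕ → Prop} (hrr : r ≠ r') {g : ℕ → α}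
    (hg : g r = g r') (p : ℕ) (j : Fin 2) :
    (nbr l r r' L p j).map (fun u => g u.1) = (posNbr l r r' L p).map g := by
  by_cases hp : p = 0
  · subst hp
    fin_cases j <;> simp [nbr, posNbr, hg]
  · have hX : ((if p = r then {g 0} else 0) + (if p = r' then {g 0} else 0) : Multiset α) =
        if p = r ∨ p = r' then {g 0} else 0 := by
      split_ifs <;> first | omega | rfl
    simp only [nbr, posNbr, armNbr, if_neg hp, Multiset.map_add, map_ite_zero,
      Multiset.map_singleton, add_assoc, hX]

namespace Layout

variable {Ξ : List Letter} {r r' : ℕ} {L : ℕ → Prop}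

theorem map_neighborFinset_comp {α : Type*} (h : Layout Ξ r r' L) (c : ℕ × Fin 2 → α)
    (v : Fin Ξ.length × Fin 2) :
    ((encodedGraph Ξ).neighborFinset v).val.map (fun u => c (u.1.val, u.2)) =
      (nbr Ξ.length r r' L v.1 v.2).map c := by
  rw [← h.map_neighborFinset, Multiset.map_map]
  rfl

theorem map_neighborFinset_pos {α : Type*} (h : Layout Ξ r r' L) {g : ℕ → α} (hg : g r = g r')
    (v : Fin Ξ.length × Fin 2) :
    ((encodedGraph Ξ).neighborFinset v).val.map (fun u => g u.1) =
      (posNbr Ξ.length r r' L v.1).map g := by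
  rw [← map_nbr_eq_map_posNbr h.lt.ne hg v.1 v.2]
  exact h.map_neighborFinset_comp (fun u => g u.1) v

theorem degree_eq (h : Layout Ξ r r' L) (v : Fin Ξ.length × Fin 2) :
    (encodedGraph Ξ).degree v = (posNbr Ξ.length r r' L v.1).card := by
  simpa using congrArg Multiset.card (h.map_neighborFinset_pos (g := fun _ => ()) rfl v)

theorem not_one_of_X (h : Layout Ξ r r' L) {p : ℕ} (hp : p = r ∨ p = r') : ¬ L p := by
  have hl := h.lt_length
  have hlt := h.lt
  have hpl : p < Ξ.length := by omega
  intro hL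
  have h1 := (h.eq_one p hpl).2 hL
  rw [(h.eq_X p hpl).2 hp] at h1
  cases h1

theorem range_degree (h : Layout Ξ r r' L)
    (hp : ∃ p, 0 < p ∧ p < Ξ.length ∧ ¬ L p ∧ p ≠ r ∧ p ≠ r') :
    Set.range (fun v => (encodedGraph Ξ).degree v) = {2, 3} := by
  have hl := h.lt_length
  have h2 := h.two_le
  have hlt := h.lt
  ext d
  simp only [Set.mem_range, Set.mem_insert_iff, Set.mem_singleton_iff, h.degree_eq]
  constructor
  · rintro ⟨v, rfl⟩
    have hv := v.1.2
    have hX := h.not_one_of_X (p := v.1)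
    unfold posNbr armNbr
    split_ifs <;> simp <;> grind
  · rintro (rfl | rfl)
    · obtain ⟨p, h0, hpl, hL, hr, hr'⟩ := hp
      refine ⟨(⟨p, hpl⟩, 0), ?_⟩
      unfold posNbr armNbr
      have : p ≠ 0 := by omega
      by_cases hpl' : p + 1 = Ξ.length
      · have : ¬ p + 1 < Ξ.length := by omega
        simp [*]
      · have : p + 1 < Ξ.length := by omega
        simp [*]
    · exact ⟨(⟨0, by omega⟩, 0), by simp [posNbr]⟩

/-- Once the pairs are the colour classes, they are split one after the other. -/
theorem partition_add_of_eq_pairs (h : Layout Ξ r r' L) {t : ℕ}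
    (ht : partition (encodedGraph Ξ) t = Setoid.ker fun v => v.1.val) {n : ℕ}
    (hn : n ≤ Ξ.length) :
    partition (encodedGraph Ξ) (t + n) =
      Setoid.ker fun v => (v.1.val, min (if v.2 = 0 then v.1.val else Ξ.length) n) := by
  have hl := h.lt_length
  have h2 := h.two_le
  have hlt := h.lt
  -- The value `Ξ.length` of the second vertices lies beyond every round, so round `p` splits off
  -- the first vertex of pair `p` and nothing else.
  have key := partition_chain (G := encodedGraph Ξ) (fun v => v.1.val)
    (fun v => if v.2 = 0 then v.1.val else Ξ.length) (t := t) (s₀ := 0) n ?_ ?_ ?_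
  · simpa only [Nat.zero_add] using key
  · rw [ht]
    ext v w
    simp [Setoid.ker_def]
  · intro s v w _ hs
    have e := h.map_neighborFinset_comp
      (fun u => (u.1, min (if u.2 = 0 then u.1 else Ξ.length) s))
    rw [e, e]
    obtain ⟨⟨p, hp⟩, j⟩ := v
    obtain ⟨⟨q, hq⟩, j'⟩ := w
    rintro (rfl : p = q) hpq
    simp only at hpq ⊢
    by_cases hj : j = j'
    · rw [hj]
    have hsp : s < p := by
      fin_cases j <;> fin_cases j' <;> simp_all <;> omega
    have hp0 : p ≠ 0 := by omega
    unfold nbr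
    simp only [if_neg hp0, Multiset.map_add, map_ite_zero, Multiset.map_singleton]
    have hmin : ∀ x (i i' : Fin 2), s ≤ x →
        min (if i = 0 then x else Ξ.length) s = min (if i' = 0 then x else Ξ.length) s := by
      intro x i i' hx
      split_ifs <;> omega
    rw [hmin (p - 1) j j' (by omega), hmin (p + 1) j j' (by omega),
      hmin p (1 - j) (1 - j') (by omega)]
  · intro v w _ hs
    have e := fun s => h.map_neighborFinset_comp
      (fun u => (u.1, min (if u.2 = 0 then u.1 else Ξ.length) s))
    rw [e, e]
    obtain ⟨⟨p, hp⟩, j⟩ := v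
    obtain ⟨⟨q, hq⟩, j'⟩ := w
    rintro (rfl : p = q) hpq
    simp only at hpq ⊢
    obtain ⟨rfl, rfl⟩ : j = 0 ∧ j' = 1 := by
      fin_cases j <;> fin_cases j' <;> simp_all
      omega
    simp only [if_true]
    intro heq
    by_cases hp0 : p = 0
    -- Only the first vertex of pair 0 has neighbours at position `r`.
    · have hm := congrArg (fun s => (r, 0) ∈ s) heq
      simp [nbr, hp0] at hm
      omega
    -- Truncated at `p`, the first vertex of the previous pair still has value `p - 1`, while the
    -- second one has value `p`.
    · have hm := congrArg (fun s => (p - 1, p - 1) ∈ s) heq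
      simp only [nbr, if_neg hp0, Multiset.map_add, map_ite_zero, Multiset.map_singleton,
        Multiset.mem_add, Multiset.mem_singleton, Prod.mk.injEq, eq_iff_iff] at hm
      have hm := hm.1 (by simp)
      split_ifs at hm <;> simp at hm <;> omega

theorem isLongRefinement (h : Layout Ξ r r' L)
    (ht : partition (encodedGraph Ξ) (Ξ.length - 1) = Setoid.ker fun v => v.1.val) :
    IsLongRefinement (encodedGraph Ξ) := by
  have hl := h.lt_length
  have h1 := h.partition_add_of_eq_pairs ht (n := Ξ.length) le_rfl
  have h2 := h.partition_add_of_eq_pairs ht (n := Ξ.length - 1) (by omega)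
  have hit : iterationNumber (encodedGraph Ξ) = Ξ.length - 1 + (Ξ.length - 1) + 1 := by
    refine iterationNumber_eq ?_ ?_
    · rw [show Ξ.length - 1 + (Ξ.length - 1) + 1 = Ξ.length - 1 + Ξ.length by omega, h1]
      refine Setoid.ker_eq_bot_iff.2 ?_
      rintro ⟨⟨p, hp⟩, j⟩ ⟨⟨q, hq⟩, j'⟩ hpq
      obtain ⟨rfl : p = q, hj⟩ := Prod.mk.inj hpq
      fin_cases j <;> fin_cases j' <;> simp_all <;> omega
    -- One round earlier the last pair is still a single class.
    · rw [h2]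
      intro hbot
      have := Setoid.ker_eq_bot_iff.1 hbot (a₁ := (⟨Ξ.length - 1, by omega⟩, 0))
        (a₂ := (⟨Ξ.length - 1, by omega⟩, 1)) (by simp)
      simp at this
  rw [IsLongRefinement, hit, Fintype.card_prod, Fintype.card_fin, Fintype.card_fin]
  omega

end Layout

end Phases

/-! ### From the initial partition to the folded classes and on to the pairs -/

section Folding

namespace Layout

variable {Ξ : List Letter} {r r' : ℕ} {L : ℕ → Prop}

/-- If the vertex pairs are folded by `f`, the colour classes split along the values of `f`. -/
theorem partition_eq_fold (h : Layout Ξ r r' L) {β : Type*} (b : ℕ → β) (f : ℕ → ℕ) {t n : ℕ}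
    (ht : partition (encodedGraph Ξ) t = Setoid.ker fun v => b (f v.1)) (hrr : f r = f r')
    (heq : ∀ p q, p < Ξ.length → q < Ξ.length → p < q → f p = f q →
      ((posNbr Ξ.length r r' L p).map f).map (fun i => (b i, min i (n - 1))) =
        ((posNbr Ξ.length r r' L q).map f).map (fun i => (b i, min i (n - 1))))
    (hlt : ∀ p q, p < Ξ.length → q < Ξ.length → 0 < f p → f p < f q → b (f p) = b (f q) →
      ((posNbr Ξ.length r r' L p).map f).map b = ((posNbr Ξ.length r r' L q).map f).map b ∧
        (∀ i ∈ (posNbr Ξ.length r r' L p).map f, f p ≤ i + 1) ∧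
        (∀ i ∈ (posNbr Ξ.length r r' L q).map f, f p ≤ i + 1) ∧
        ((posNbr Ξ.length r r' L p).map f).count (f p - 1) ≠
          ((posNbr Ξ.length r r' L q).map f).count (f p - 1))
    (hzero : ∀ p q, p < Ξ.length → q < Ξ.length → f p = 0 → 0 < f q → b 0 = b (f q) →
      ((posNbr Ξ.length r r' L p).map f).map b ≠ ((posNbr Ξ.length r r' L q).map f).map b)
    (hend : ∀ p q, p < Ξ.length → q < Ξ.length → n ≤ f p → f p < f q → b (f p) ≠ b (f q)) :
    partition (encodedGraph Ξ) (t + n) = Setoid.ker fun v => f v.1 := by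
  have e : ∀ s (v : Fin Ξ.length × Fin 2),
      ((encodedGraph Ξ).neighborFinset v).val.map (fun u => (b (f u.1), min (f u.1) s)) =
        ((posNbr Ξ.length r r' L v.1).map f).map (fun i => (b i, min i s)) := by
    intro s v
    rw [Multiset.map_map]
    exact h.map_neighborFinset_pos (g := fun p => (b (f p), min (f p) s)) (by rw [hrr]) v
  -- Truncation at `n - 1` is the finest view that any of the `n` rounds has, so agreement there
  -- gives agreement in all of them.
  have hco : ∀ (m₁ m₂ : Multiset ℕ) (c s : ℕ), s ≤ c →
      m₁.map (fun i => (b i, min i c)) = m₂.map (fun i => (b i, min i c)) →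
      m₁.map (fun i => (b i, min i s)) = m₂.map (fun i => (b i, min i s)) := by
    intro m₁ m₂ c s hs hm
    refine map_eq_map_of_ker_le (fun i j hij => ?_) hm
    simp only [Prod.mk.injEq] at hij ⊢
    exact ⟨hij.1, by omega⟩
  have hge : ∀ (m : Multiset ℕ) (s : ℕ), (∀ i ∈ m, s ≤ i) →
      m.map (fun i => (b i, min i s)) = (m.map b).map fun x => (x, s) := by
    intro m s hm
    rw [Multiset.map_map]
    refine Multiset.map_congr rfl fun i hi => ?_
    simp [hm i hi]
  have key := partition_chain (G := encodedGraph Ξ) (fun v => b (f v.1)) (fun v => f v.1)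
    (t := t) (s₀ := 0) n ?_ ?_ ?_
  · rw [key]
    ext v w
    simp only [Setoid.ker_def, Nat.zero_add, Prod.mk.injEq]
    refine ⟨fun ⟨hb, hm⟩ => ?_, fun hf => by simp [hf]⟩
    by_contra hne
    rcases Nat.lt_or_gt_of_ne hne with hl | hl
    · exact hend _ _ v.1.2 w.1.2 (by omega) hl hb
    · exact hend _ _ w.1.2 v.1.2 (by omega) hl hb.symm
  · rw [ht]
    ext v w
    simp [Setoid.ker_def]
  · intro s v w _ hs ha hvw
    rw [e, e]
    have hsame : ∀ v w : Fin Ξ.length × Fin 2, s < f v.1 → f v.1 < f w.1 → b (f v.1) = b (f w.1) →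
        ((posNbr Ξ.length r r' L v.1).map f).map (fun i => (b i, min i s)) =
          ((posNbr Ξ.length r r' L w.1).map f).map (fun i => (b i, min i s)) := by
      intro v w hv hf ha
      obtain ⟨h1, h2, h3, -⟩ := hlt v.1 w.1 v.1.2 w.1.2 (by omega) hf ha
      -- All neighbours have value at least `f v.1 - 1 ≥ s`, so truncation at `s` leaves only their
      -- `b`-values.
      rw [hge _ s fun i hi => by have := h2 i hi; omega,
        hge _ s fun i hi => by have := h3 i hi; omega, h1]
    rcases lt_trichotomy (f v.1) (f w.1) with hf | hf | hf
    · exact hsame v w (by omega) hf ha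
    · rcases lt_trichotomy v.1.val w.1.val with hp | hp | hp
      · exact hco _ _ (n - 1) s (by omega) (heq _ _ v.1.2 w.1.2 hp hf)
      · rw [hp]
      · exact (hco _ _ (n - 1) s (by omega) (heq _ _ w.1.2 v.1.2 hp hf.symm)).symm
    · exact (hsame w v (by omega) hf ha.symm).symm
  · intro v w _ hs ha hf
    simp only [e] at hf ⊢
    intro hm
    rcases Nat.eq_zero_or_pos (f v.1) with h0 | h0
    · refine hzero v.1 w.1 v.1.2 w.1.2 h0 (by omega) (by rw [← h0]; exact ha) ?_
      simpa [Multiset.map_map, Function.comp_def] using congrArg (Multiset.map Prod.fst) hm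
    · refine (hlt v.1 w.1 v.1.2 w.1.2 h0 hf ha).2.2.2 ?_
      -- In round `f v.1`, which is positive here, the value `f v.1 - 1` is the largest one that
      -- truncation leaves visible.
      have hcount : ∀ m : Multiset ℕ,
          (m.map fun i => (b i, min i (f v.1))).countP (fun x => x.2 = f v.1 - 1) =
            m.count (f v.1 - 1) := by
        intro m
        rw [Multiset.countP_map, ← Multiset.countP_eq_card_filter]
        refine Multiset.countP_congr rfl fun i _ => ?_
        simp only [eq_iff_iff]
        omega
      rw [← hcount, ← hcount, hm]

/-- If the colour classes are the fibres of `f`, with the first `q₀` pairs being separated from all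
others, then the remaining classes are split one position at a time. -/
theorem partition_eq_pairs (h : Layout Ξ r r' L) (f : ℕ → ℕ) {t q₀ : ℕ} (hq₀ : q₀ ≤ r)
    (ht : partition (encodedGraph Ξ) t = Setoid.ker fun v => f v.1) (hrr : f r = f r')
    (hsing : ∀ p q, p < q₀ → q < Ξ.length → f p = f q → p = q)
    (harm : ∀ p q, q₀ < p → p < q → q < Ξ.length → f p = f q →
      (armNbr Ξ.length L p).map f = (armNbr Ξ.length L q).map f ∧
        (p = r ∨ p = r' ↔ q = r ∨ q = r'))
    (hone : f 1 ≠ f r)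
    (hzero : q₀ = 0 → ∀ p, 0 < p → p < Ξ.length → f 0 = f p →
      (posNbr Ξ.length r r' L 0).map f ≠ (posNbr Ξ.length r r' L p).map f)
    (hend : ∀ p q, r < p → p < q → q < Ξ.length → f p ≠ f q) :
    partition (encodedGraph Ξ) (t + (r + 1 - q₀)) = Setoid.ker fun v => v.1.val := by
  have hlen := h.lt_length
  have h2 := h.two_le
  have hlt := h.lt
  -- Truncation at `s ≤ r` does not distinguish `r` from `r'`, so colours depend on positions only,
  -- up to and including round `r`.
  have e : ∀ s ≤ r, ∀ v : Fin Ξ.length × Fin 2,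
      ((encodedGraph Ξ).neighborFinset v).val.map (fun u => (f u.1, min u.1.val s)) =
        (posNbr Ξ.length r r' L v.1).map (fun p => (f p, min p s)) := by
    intro s hs v
    refine h.map_neighborFinset_pos (g := fun p => (f p, min p s)) ?_ v
    rw [hrr, Prod.mk.injEq]
    exact ⟨rfl, by omega⟩
  have key := partition_chain (G := encodedGraph Ξ) (fun v => f v.1) (fun v => v.1.val)
    (t := t) (s₀ := q₀) (r + 1 - q₀) ?_ ?_ ?_
  · rw [key]
    ext v w
    simp only [Setoid.ker_def, Prod.mk.injEq]
    refine ⟨fun ⟨hb, hm⟩ => ?_, fun hf => by simp [hf]⟩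
    by_contra hne
    rcases Nat.lt_or_gt_of_ne hne with hl | hl
    · exact hend _ _ (by omega) hl w.1.2 hb
    · exact hend _ _ (by omega) hl v.1.2 hb.symm
  · rw [ht]
    ext v w
    simp only [Setoid.ker_def, Prod.mk.injEq]
    refine ⟨fun hf => ⟨hf, ?_⟩, fun hf => hf.1⟩
    by_contra hne
    have hvw : v.1.val ≠ w.1.val := fun hvw => hne (by rw [hvw])
    by_cases hv : v.1.val < q₀
    · exact hvw (hsing _ _ hv w.1.2 hf)
    · by_cases hw : w.1.val < q₀
      · exact hvw (hsing _ _ hw v.1.2 hf.symm).symm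
      · omega
  · intro s v w hs hsr ha hvw
    rw [e s (by omega), e s (by omega)]
    have hmap : ∀ p, s < p → (posNbr Ξ.length r r' L p).map (fun p => (f p, min p s)) =
        ((armNbr Ξ.length L p).map f).map (fun i => (i, s)) +
          if p = r ∨ p = r' then {(f 0, 0)} else 0 := by
      intro p hp
      rw [posNbr, if_neg (by omega), Multiset.map_add, map_ite_zero, Multiset.map_singleton,
        Nat.zero_min, Multiset.map_map]
      refine congrArg₂ _ (Multiset.map_congr rfl fun x hx => ?_) rfl
      have hxs : s ≤ x := by
        unfold armNbr at hx
        split_ifs at hx <;> simp at hx <;> omega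
      simp [hxs]
    have hsame : ∀ p q, s < p → p < q → q < Ξ.length → f p = f q →
        (posNbr Ξ.length r r' L p).map (fun p => (f p, min p s)) =
          (posNbr Ξ.length r r' L q).map (fun p => (f p, min p s)) := by
      intro p q hp hpq hq hf
      obtain ⟨h1, h2⟩ := harm p q (by omega) hpq hq hf
      rw [hmap p hp, hmap q (by omega), h1]
      simp only [h2]
    rcases lt_trichotomy v.1.val w.1.val with hp | hp | hp
    · exact hsame _ _ (by omega) hp w.1.2 ha
    · rw [hp]
    · exact (hsame _ _ (by omega) hp v.1.2 ha.symm).symm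
  · intro v w hv hvr ha hvw
    simp only [e _ (show v.1.val ≤ r by omega)]
    have hw := w.1.2
    intro hm
    rcases Nat.eq_zero_or_pos v.1.val with h0 | h0
    · refine hzero (by omega) w.1 (by omega) w.1.2 (by rw [← h0]; exact ha) ?_
      rw [h0] at hm
      simpa [Multiset.map_map, Function.comp_def] using congrArg (Multiset.map Prod.fst) hm
    -- Position `v.1` is recognised by its neighbour at `v.1 - 1`, which is already isolated.
    · have hmem : (f (v.1 - 1), v.1.val - 1) ∈
          (posNbr Ξ.length r r' L w.1).map (fun p => (f p, min p v.1)) := by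
        rw [← hm, posNbr, if_neg h0.ne', armNbr]
        simp
      obtain ⟨x, hx, hxv⟩ := Multiset.mem_map.1 hmem
      rw [Prod.mk.injEq] at hxv
      -- A position further right can only see `v.1 - 1` through an X edge to position 0. Then `v.1`
      -- is 1, and `hone` rules out that it shares its class with an X.
      have hX : x = 0 ∧ (w.1.val = r ∨ w.1.val = r') := by
        rw [posNbr, if_neg (by omega), armNbr] at hx
        split_ifs at hx <;> simp at hx <;> omega
      have hv1 : v.1.val = 1 := by omega
      rw [hv1] at ha
      rcases hX.2 with hX | hX
      · exact hone (ha.trans (by rw [hX]))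
      · exact hone (ha.trans (by rw [hX, hrr]))

end Layout

end Folding

/-! ### The fold into three layers -/

section Folding

/-- Folds the interval of length `l` into three layers, at the positions `m` and `c`; the value is
the distance to the end of the layer. -/
def fold (m c l p : ℕ) : ℕ := if p ≤ m then m - p else if p ≤ c then p - (m + 1) else l - 1 - p

variable {m c l p : ℕ} {L : ℕ → Prop}

theorem fold_of_le (hp : p ≤ m) : fold m c l p = m - p := if_pos hp

theorem fold_of_lt_of_le (hp : m < p) (hp' : p ≤ c) : fold m c l p = p - (m + 1) := by
  rw [fold, if_neg (by omega), if_pos hp']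

theorem fold_of_lt (hmc : m < c) (hp : c < p) : fold m c l p = l - 1 - p := by
  rw [fold, if_neg (by omega), if_neg (by omega)]

theorem map_armNbr {α : Type*} (f : ℕ → α) [Decidable (L p)] (hp : p + 1 < l) :
    (armNbr l L p).map f = {f (p - 1)} + {f (p + 1)} + (if L p then {f p} else 0) := by
  unfold armNbr
  have : ¬ p + 1 = l := by omega
  by_cases hL : L p <;> simp [*]

theorem map_armNbr_last {α : Type*} (f : ℕ → α) (hp : p + 1 = l) :
    (armNbr l L p).map f = {f (p - 1), f p} := by
  unfold armNbr
  simp [hp]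

/-- In the interior of a layer `f` changes by one per step. The hypotheses exclude the ends of
layers: position 0, the zeros of `f`, and the turn between `c` and `c + 1`. -/
theorem map_armNbr_fold [Decidable (L p)] (hmc : m < c) (hc : c + 1 < l) (hp : 0 < p)
    (hpl : p < l) (hpc : p ≠ c) (hpc' : p ≠ c + 1) (hf : 0 < fold m c l p) :
    (armNbr l L p).map (fold m c l) =
      {fold m c l p - 1} + {fold m c l p + 1} + (if L p then {fold m c l p} else 0) := by
  have hpl : p + 1 < l := by
    by_contra h
    rw [fold_of_lt hmc (by omega)] at hf
    omega
  rw [map_armNbr _ hpl]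
  congr 1
  rcases le_or_gt p m with h | h
  · rw [fold_of_le h] at hf ⊢
    rw [fold_of_le (by omega), fold_of_le (by omega), add_comm]
    congr 2 <;> omega
  · rcases le_or_gt p c with h' | h'
    · rw [fold_of_lt_of_le h h'] at hf ⊢
      rw [fold_of_lt_of_le (by omega) (by omega), fold_of_lt_of_le (by omega) (by omega)]
      congr 2 <;> omega
    · rw [fold_of_lt hmc h'] at hf ⊢
      rw [fold_of_lt hmc (by omega), fold_of_lt hmc (by omega), add_comm]
      congr 2 <;> omega

/-- The positions `m` and `m + 1` see each other across the crease; at the last position, the edge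
inside the pair supplies the same neighbour of value 0. -/
theorem map_armNbr_fold_zero (hm : 0 < m) (hmc : m + 2 ≤ c) (hc : c + 2 < l) (hp : p < l)
    (hL : p + 1 < l → ¬ L p) (hf : fold m c l p = 0) :
    (armNbr l L p).map (fold m c l) = {0, 1} := by
  classical
  have hcases : p = m ∨ p = m + 1 ∨ p + 1 = l := by
    unfold fold at hf
    split_ifs at hf <;> omega
  rcases hcases with rfl | rfl | hl
  · rw [map_armNbr _ (by omega), if_neg (hL (by omega)), fold_of_le (by omega),
      fold_of_lt_of_le (by omega) (by omega), add_comm {_} {_}]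
    have : p - (p - 1) = 1 := by omega
    simp [this]
  · rw [map_armNbr _ (by omega), if_neg (hL (by omega)), fold_of_le (by omega),
      fold_of_lt_of_le (by omega) (by omega)]
    simp
  · rw [map_armNbr_last _ hl, hf, fold_of_lt (by omega) (by omega), Multiset.pair_comm]
    have : l - 1 - (p - 1) = 1 := by omega
    rw [this]

theorem map_armNbr_fold_left [Decidable (L c)] (hmc : m + 2 ≤ c) (hc : c + 1 < l) :
    (armNbr l L c).map (fold m c l) =
      {fold m c l c - 1} + {fold m c l (c + 1)} + (if L c then {fold m c l c} else 0) := by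
  rw [map_armNbr _ hc]
  congr 3
  rw [fold_of_lt_of_le (by omega) (by omega), fold_of_lt_of_le (by omega) (by omega)]
  omega

theorem map_armNbr_fold_right [Decidable (L (c + 1))] (hmc : m < c) (hc : c + 2 < l) :
    (armNbr l L (c + 1)).map (fold m c l) =
      {fold m c l c} + {fold m c l (c + 1) - 1} +
        (if L (c + 1) then {fold m c l (c + 1)} else 0) := by
  rw [map_armNbr _ hc]
  congr 3
  rw [fold_of_lt hmc (by omega), fold_of_lt hmc (by omega)]
  omega

/-- The positions of the letter `1` in a string with the letter `X` at the positions `r` and `r'`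
and the letter `0` at those positions whose value under `f` is divisible by `z`. -/
abbrev OnesOf (z : ℕ) (f : ℕ → ℕ) (r r' p : ℕ) : Prop := f p % z ≠ 0 ∧ p ≠ 0 ∧ p ≠ r ∧ p ≠ r'

end Folding

/-! ### Letters of repeated words -/

section Words

open Letter

theorem length_rep (w : List Letter) (k : ℕ) : (rep w k).length = k * w.length := by
  simp [rep]

theorem rep_succ (w : List Letter) (k : ℕ) : rep w (k + 1) = w ++ rep w k := by
  simp [rep, List.replicate_succ]

theorem getElem?_rep (w : List Letter) (k i : ℕ) :
    (rep w k)[i]? = if i < k * w.length then w[i % w.length]? else none := by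
  induction k generalizing i with
  | zero => simp [rep]
  | succ k ih =>
    rw [rep_succ, List.getElem?_append, ih, Nat.succ_mul]
    by_cases hi : i < w.length
    · rw [if_pos hi, if_pos (by omega), Nat.mod_eq_of_lt hi]
    · rw [if_neg hi, ← Nat.mod_eq_sub_mod (by omega)]
      exact if_congr (by omega) rfl rfl

theorem count_rep (a : Letter) (w : List Letter) (k : ℕ) :
    (rep w k).count a = k * w.count a := by
  induction k with
  | zero => simp [rep]
  | succ k ih => rw [rep_succ, List.count_append, ih, Nat.succ_mul, add_comm]

theorem getElem?_rep_one (k i : ℕ) : (rep [one] k)[i]? = if i < k then some one else none := by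
  simp [getElem?_rep, Nat.mod_one]

theorem getElem?_rep_triple (a b c : Letter) (k i : ℕ) :
    (rep [a, b, c] k)[i]? =
      if i < 3 * k then some (if i % 3 = 0 then a else if i % 3 = 1 then b else c) else none := by
  have : i % 3 < 3 := Nat.mod_lt _ (by norm_num)
  rw [getElem?_rep, mul_comm k]
  refine if_congr Iff.rfl ?_ rfl
  change [a, b, c][i % 3]? = _
  generalize i % 3 = j at *
  interval_cases j <;> rfl

theorem Layout.of_getElem? {Ξ : List Letter} {r r' : ℕ} {L : ℕ → Prop} [DecidablePred L]
    (h2 : 2 ≤ r) (hlt : r < r') (hl : r' < Ξ.length) (h0 : ¬ L 0)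
    (hL : ∀ i, L i → i ≠ r ∧ i ≠ r')
    (hΞ : ∀ i < Ξ.length, Ξ[i]? = some
      (if i = r ∨ i = r' then X else if L i then one else if i = 0 then S else zero)) :
    Layout Ξ r r' L where
  two_le := h2
  lt := hlt
  lt_length := hl
  not_zero := h0
  eq_X i hi := by
    rw [List.getElem_eq_iff, hΞ i hi, Option.some_inj]
    split_ifs <;> simp_all
  eq_one i hi := by
    rw [List.getElem_eq_iff, hΞ i hi, Option.some_inj]
    split_ifs with hX h1
    · exact iff_of_false (by simp) fun h => by have := hL i h; omega
    · exact iff_of_true rfl h1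
    · exact iff_of_false (by simp) h1
    · exact iff_of_false (by simp) h1

end Words

/-! ### The five families: layouts and folded neighbourhoods -/

open Letter

theorem length_family1 (k : ℕ) : (family1 k).length = 3 * k + 7 := by
  simp [family1, length_rep]; omega
theorem length_family2 (k : ℕ) : (family2 k).length = 3 * k + 8 := by
  simp [family2, length_rep]; omega
theorem length_family3 (k : ℕ) : (family3 k).length = 3 * k + 8 := by
  simp [family3, length_rep]; omega
theorem length_family4 (k : ℕ) : (family4 k).length = 9 * k + 9 := by
  simp [family4, length_rep]; omega
theorem length_family5 (k : ℕ) : (family5 k).length = 9 * k + 9 := by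
  simp [family5, length_rep]; omega

/-- Since `n % 0 = n`, the parameter `z = 0` puts the letter 0 exactly at the zeros of the fold. The
parameters `m` and `m + 1` are the positions of the word 00, and `c`, `c + 1` surround the turn near
the letters X. -/
theorem layout_family1 (k : ℕ) : Layout (family1 k) (2 * k + 3) (2 * k + 5)
    (OnesOf 0 (fold (k + 1) (2 * k + 4) (3 * k + 7)) (2 * k + 3) (2 * k + 5)) := by
  refine Layout.of_getElem? (by omega) (by omega) (by rw [length_family1]; omega) (by simp)
    (fun i hi => hi.2.2) ?_
  rw [length_family1]
  intro i hi
  simp only [family1, List.getElem?_append, getElem?_rep_one, length_rep, List.getElem?_cons,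
    List.length_append, List.length_cons, List.length_nil, List.getElem?_nil, fold, OnesOf]
  split_ifs <;> first | rfl | omega

theorem layout_family2 (k : ℕ) : Layout (family2 k) (2 * k + 5) (2 * k + 6)
    (OnesOf 0 (fold (k + 3) (2 * k + 5) (3 * k + 8)) (2 * k + 5) (2 * k + 6)) := by
  refine Layout.of_getElem? (by omega) (by omega) (by rw [length_family2]; omega) (by simp)
    (fun i hi => hi.2.2) ?_
  rw [length_family2]
  intro i hi
  simp only [family2, List.getElem?_append, getElem?_rep_one, length_rep, List.getElem?_cons,
    List.length_append, List.length_cons, List.length_nil, List.getElem?_nil, fold, OnesOf]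
  split_ifs <;> first | rfl | omega

theorem layout_family3 (k : ℕ) : Layout (family3 k) (2 * k + 4) (2 * k + 5)
    (OnesOf 0 (fold (k + 1) (2 * k + 4) (3 * k + 8)) (2 * k + 4) (2 * k + 5)) := by
  refine Layout.of_getElem? (by omega) (by omega) (by rw [length_family3]; omega) (by simp)
    (fun i hi => hi.2.2) ?_
  rw [length_family3]
  intro i hi
  simp only [family3, List.getElem?_append, getElem?_rep_one, length_rep, List.getElem?_cons,
    List.length_append, List.length_cons, List.length_nil, List.getElem?_nil, fold, OnesOf]
  split_ifs <;> first | rfl | omega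

set_option maxHeartbeats 1000000 in
theorem layout_family4 (k : ℕ) : Layout (family4 k) (6 * k + 6) (6 * k + 7)
    (OnesOf 3 (fold (3 * k + 4) (6 * k + 6) (9 * k + 9)) (6 * k + 6) (6 * k + 7)) := by
  refine Layout.of_getElem? (by omega) (by omega) (by rw [length_family4]; omega) (by simp)
    (fun i hi => hi.2.2) ?_
  rw [length_family4]
  intro i hi
  have hrep : family4 k = [S] ++ rep [zero, one, one] (k + 1) ++ [zero, zero] ++
      rep [one, one, zero] k ++ [X, X] ++ rep [zero, one, one] k ++ [zero] := by
    simp [family4, rep_succ]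
  simp only [hrep, List.getElem?_append, getElem?_rep_triple, length_rep, List.getElem?_cons,
    List.length_append, List.length_cons, List.length_nil, List.getElem?_nil, fold, OnesOf]
  split_ifs <;> first | rfl | omega

set_option maxHeartbeats 1000000 in
theorem layout_family5 (k : ℕ) : Layout (family5 k) (6 * k + 4) (6 * k + 6)
    (OnesOf 3 (fold (3 * k + 1) (6 * k + 5) (9 * k + 9)) (6 * k + 4) (6 * k + 6)) := by
  refine Layout.of_getElem? (by omega) (by omega) (by rw [length_family5]; omega) (by simp)
    (fun i hi => hi.2.2) ?_
  rw [length_family5]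
  intro i hi
  simp only [family5, List.getElem?_append, getElem?_rep_triple, length_rep, List.getElem?_cons,
    List.length_append, List.length_cons, List.length_nil, List.getElem?_nil, fold, OnesOf]
  split_ifs <;> first | rfl | omega

theorem map_armNbr_fold_one {z m c l r r' p : ℕ} (hmc : m < c) (hc : c + 1 < l)
    (hp : 0 < p) (hpl : p < l) (hpc : p ≠ c) (hpc' : p ≠ c + 1) (hf : 0 < fold m c l p)
    (hz : fold m c l p % z ≠ 0) (hr : p ≠ r) (hr' : p ≠ r') :
    (armNbr l (OnesOf z (fold m c l) r r') p).map (fold m c l) =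
      {fold m c l p - 1, fold m c l p + 1, fold m c l p} := by
  rw [map_armNbr_fold hmc hc hp hpl hpc hpc' hf, if_pos ⟨hz, hp.ne', hr, hr'⟩]
  simp

theorem map_armNbr_fold_of_not {z m c l r r' p : ℕ} (hmc : m < c) (hc : c + 1 < l)
    (hp : 0 < p) (hpl : p < l) (hpc : p ≠ c) (hpc' : p ≠ c + 1) (hf : 0 < fold m c l p)
    (hz : fold m c l p % z = 0 ∨ p = r ∨ p = r') :
    (armNbr l (OnesOf z (fold m c l) r r') p).map (fold m c l) =
      {fold m c l p - 1, fold m c l p + 1} := by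
  rw [map_armNbr_fold hmc hc hp hpl hpc hpc' hf,
    if_neg fun h => by obtain ⟨h1, -, h2, h3⟩ := h; tauto]
  simp

theorem map_armNbr_fold_left_of_not {z m c l r r' : ℕ} (hmc : m + 2 ≤ c) (hc : c + 1 < l)
    (hz : fold m c l c % z = 0 ∨ c = r ∨ c = r') :
    (armNbr l (OnesOf z (fold m c l) r r') c).map (fold m c l) =
      {fold m c l c - 1, fold m c l (c + 1)} := by
  rw [map_armNbr_fold_left hmc hc, if_neg fun h => by obtain ⟨h1, -, h2, h3⟩ := h; tauto]
  simp

theorem map_armNbr_fold_right_of_not {z m c l r r' : ℕ} (hmc : m < c) (hc : c + 2 < l)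
    (hz : fold m c l (c + 1) % z = 0 ∨ c + 1 = r ∨ c + 1 = r') :
    (armNbr l (OnesOf z (fold m c l) r r') (c + 1)).map (fold m c l) =
      {fold m c l c, fold m c l (c + 1) - 1} := by
  rw [map_armNbr_fold_right hmc hc, if_neg fun h => by obtain ⟨h1, -, h2, h3⟩ := h; tauto]
  simp

/-- Without the X edges, the folded neighbourhood is determined by the folded value, so the layers
look alike. The turn is the letter 1 in X1X: it carries the largest value and sees the two X
symmetrically. -/
theorem armNbr_family1 (k p : ℕ) (hp0 : 0 < p) (hp : p < 3 * k + 7) {f : ℕ → ℕ}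
    (hf : f = fold (k + 1) (2 * k + 4) (3 * k + 7)) {A : ℕ → Multiset ℕ}
    (hA : A = fun p => (armNbr (3 * k + 7) (OnesOf 0 f (2 * k + 3) (2 * k + 5)) p).map f) :
    (¬ (p = 2 * k + 3 ∨ p = 2 * k + 5) ∧ f p = 0 ∧ A p = {0, 1}) ∨
      (¬ (p = 2 * k + 3 ∨ p = 2 * k + 5) ∧ 0 < f p ∧ f p ≤ k ∧ A p = {f p - 1, f p + 1, f p}) ∨
      ((p = 2 * k + 3 ∨ p = 2 * k + 5) ∧ f p = k + 1 ∧ A p = {k, k + 2}) ∨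
      (¬ (p = 2 * k + 3 ∨ p = 2 * k + 5) ∧ f p = k + 2 ∧ A p = {k + 1, k + 1, k + 2}) := by
  have hfold : ∀ p, f p = fold (k + 1) (2 * k + 4) (3 * k + 7) p := fun p => by rw [hf]
  have hfr : f (2 * k + 3) = k + 1 := by rw [hfold, fold]; split_ifs <;> omega
  have hfr' : f (2 * k + 5) = k + 1 := by rw [hfold, fold]; split_ifs <;> omega
  have hfc : f (2 * k + 4) = k + 2 := by rw [hfold, fold]; split_ifs <;> omega
  simp only [hA]
  rcases Nat.eq_zero_or_pos (f p) with hz | hz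
  · have hX : ¬ (p = 2 * k + 3 ∨ p = 2 * k + 5) := by
      rintro (rfl | rfl) <;> omega
    refine Or.inl ⟨hX, hz, ?_⟩
    subst hf
    exact map_armNbr_fold_zero (by omega) (by omega) (by omega) hp 
      (fun _ h => h.1 (by rw [hz, Nat.zero_mod])) hz
  refine Or.inr ?_
  by_cases hpr : p = 2 * k + 3
  · refine Or.inr (Or.inl ⟨Or.inl hpr, by rw [hpr, hfr], ?_⟩)
    subst hf hpr
    rw [map_armNbr_fold_of_not (by omega) (by omega) hp0 hp (by omega) (by omega) hz (by simp), hfr]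
    simp
  by_cases hpr' : p = 2 * k + 5
  · refine Or.inr (Or.inl ⟨Or.inr hpr', by rw [hpr', hfr'], ?_⟩)
    subst hf hpr'
    rw [map_armNbr_fold_right_of_not (by omega) (by omega) (by simp), hfr', hfc,
      Multiset.pair_comm]
    simp
  have hX : ¬ (p = 2 * k + 3 ∨ p = 2 * k + 5) := by omega
  by_cases hpc : p = 2 * k + 4
  · refine Or.inr (Or.inr ⟨hX, by rw [hpc, hfc], ?_⟩)
    subst hf hpc
    rw [map_armNbr_fold_left (by omega) (by omega),
      if_pos ⟨by rw [Nat.mod_zero]; omega, by omega⟩, hfc, hfr']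
    simp
  have hle : f p ≤ k := by rw [hfold, fold]; split_ifs <;> omega
  refine Or.inl ⟨hX, hz, hle, ?_⟩
  subst hf
  exact map_armNbr_fold_one (by omega) (by omega) hp0 hp hpc hpr' hz
    (by rw [Nat.mod_zero]; omega) hpr hpr'

/-- The value `k + 1` occurs in two rows: the letters X, which see their own value across the turn,
and position 2 of the longer first layer. -/
theorem armNbr_family2 (k p : ℕ) (hp0 : 0 < p) (hp : p < 3 * k + 8) {f : ℕ → ℕ}
    (hf : f = fold (k + 3) (2 * k + 5) (3 * k + 8)) {A : ℕ → Multiset ℕ}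
    (hA : A = fun p => (armNbr (3 * k + 8) (OnesOf 0 f (2 * k + 5) (2 * k + 6)) p).map f) :
    (¬ (p = 2 * k + 5 ∨ p = 2 * k + 6) ∧ f p = 0 ∧ A p = {0, 1}) ∨
      (¬ (p = 2 * k + 5 ∨ p = 2 * k + 6) ∧ 0 < f p ∧ f p ≤ k + 2 ∧
        A p = {f p - 1, f p + 1, f p}) ∨
      ((p = 2 * k + 5 ∨ p = 2 * k + 6) ∧ f p = k + 1 ∧ A p = {k, k + 1}) := by
  have hfold : ∀ p, f p = fold (k + 3) (2 * k + 5) (3 * k + 8) p := fun p => by rw [hf]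
  have hfr : f (2 * k + 5) = k + 1 := by rw [hfold, fold]; split_ifs <;> omega
  have hfr' : f (2 * k + 6) = k + 1 := by rw [hfold, fold]; split_ifs <;> omega
  simp only [hA]
  rcases Nat.eq_zero_or_pos (f p) with hz | hz
  · have hX : ¬ (p = 2 * k + 5 ∨ p = 2 * k + 6) := by
      rintro (rfl | rfl) <;> omega
    refine Or.inl ⟨hX, hz, ?_⟩
    subst hf
    exact map_armNbr_fold_zero (by omega) (by omega) (by omega) hp 
      (fun _ h => h.1 (by rw [hz, Nat.zero_mod])) hz
  refine Or.inr ?_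
  by_cases hpr : p = 2 * k + 5
  · refine Or.inr (⟨Or.inl hpr, by rw [hpr, hfr], ?_⟩)
    subst hf hpr
    rw [map_armNbr_fold_left_of_not (by omega) (by omega) (by simp), hfr, hfr']
    simp
  by_cases hpr' : p = 2 * k + 6
  · refine Or.inr (⟨Or.inr hpr', by rw [hpr', hfr'], ?_⟩)
    subst hf hpr'
    rw [map_armNbr_fold_right_of_not (by omega) (by omega) (by simp), hfr', hfr,
      Multiset.pair_comm]
    simp
  have hX : ¬ (p = 2 * k + 5 ∨ p = 2 * k + 6) := by omega
  have hle : f p ≤ k + 2 := by rw [hfold, fold]; split_ifs <;> omega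
  refine Or.inl ⟨hX, hz, hle, ?_⟩
  subst hf
  exact map_armNbr_fold_one (by omega) (by omega) hp0 hp hpr hpr' hz
    (by rw [Nat.mod_zero]; omega) hpr hpr'

theorem armNbr_family3 (k p : ℕ) (hp0 : 0 < p) (hp : p < 3 * k + 8) {f : ℕ → ℕ}
    (hf : f = fold (k + 1) (2 * k + 4) (3 * k + 8)) {A : ℕ → Multiset ℕ}
    (hA : A = fun p => (armNbr (3 * k + 8) (OnesOf 0 f (2 * k + 4) (2 * k + 5)) p).map f) :
    (¬ (p = 2 * k + 4 ∨ p = 2 * k + 5) ∧ f p = 0 ∧ A p = {0, 1}) ∨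
      (¬ (p = 2 * k + 4 ∨ p = 2 * k + 5) ∧ 0 < f p ∧ f p ≤ k + 1 ∧
        A p = {f p - 1, f p + 1, f p}) ∨
      ((p = 2 * k + 4 ∨ p = 2 * k + 5) ∧ f p = k + 2 ∧ A p = {k + 1, k + 2}) := by
  have hfold : ∀ p, f p = fold (k + 1) (2 * k + 4) (3 * k + 8) p := fun p => by rw [hf]
  have hfr : f (2 * k + 4) = k + 2 := by rw [hfold, fold]; split_ifs <;> omega
  have hfr' : f (2 * k + 5) = k + 2 := by rw [hfold, fold]; split_ifs <;> omega
  simp only [hA]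
  rcases Nat.eq_zero_or_pos (f p) with hz | hz
  · have hX : ¬ (p = 2 * k + 4 ∨ p = 2 * k + 5) := by
      rintro (rfl | rfl) <;> omega
    refine Or.inl ⟨hX, hz, ?_⟩
    subst hf
    exact map_armNbr_fold_zero (by omega) (by omega) (by omega) hp 
      (fun _ h => h.1 (by rw [hz, Nat.zero_mod])) hz
  refine Or.inr ?_
  by_cases hpr : p = 2 * k + 4
  · refine Or.inr (⟨Or.inl hpr, by rw [hpr, hfr], ?_⟩)
    subst hf hpr
    rw [map_armNbr_fold_left_of_not (by omega) (by omega) (by simp), hfr, hfr']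
    simp
  by_cases hpr' : p = 2 * k + 5
  · refine Or.inr (⟨Or.inr hpr', by rw [hpr', hfr'], ?_⟩)
    subst hf hpr'
    rw [map_armNbr_fold_right_of_not (by omega) (by omega) (by simp), hfr', hfr,
      Multiset.pair_comm]
    simp
  have hX : ¬ (p = 2 * k + 4 ∨ p = 2 * k + 5) := by omega
  have hle : f p ≤ k + 1 := by rw [hfold, fold]; split_ifs <;> omega
  refine Or.inl ⟨hX, hz, hle, ?_⟩
  subst hf
  exact map_armNbr_fold_one (by omega) (by omega) hp0 hp hpr hpr' hz
    (by rw [Nat.mod_zero]; omega) hpr hpr'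

theorem armNbr_family4 (k p : ℕ) (hp0 : 0 < p) (hp : p < 9 * k + 9) {f : ℕ → ℕ}
    (hf : f = fold (3 * k + 4) (6 * k + 6) (9 * k + 9)) {A : ℕ → Multiset ℕ}
    (hA : A = fun p => (armNbr (9 * k + 9) (OnesOf 3 f (6 * k + 6) (6 * k + 7)) p).map f) :
    (¬ (p = 6 * k + 6 ∨ p = 6 * k + 7) ∧ f p = 0 ∧ A p = {0, 1}) ∨
      (¬ (p = 6 * k + 6 ∨ p = 6 * k + 7) ∧ f p % 3 ≠ 0 ∧ f p ≤ 3 * k + 3 ∧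
        A p = {f p - 1, f p + 1, f p}) ∨
      (¬ (p = 6 * k + 6 ∨ p = 6 * k + 7) ∧ 0 < f p ∧ f p % 3 = 0 ∧ f p ≤ 3 * k + 3 ∧
        A p = {f p - 1, f p + 1}) ∨
      ((p = 6 * k + 6 ∨ p = 6 * k + 7) ∧ f p = 3 * k + 1 ∧ A p = {3 * k, 3 * k + 1}) := by
  have hfold : ∀ p, f p = fold (3 * k + 4) (6 * k + 6) (9 * k + 9) p := fun p => by rw [hf]
  have hfr : f (6 * k + 6) = 3 * k + 1 := by rw [hfold, fold]; split_ifs <;> omega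
  have hfr' : f (6 * k + 7) = 3 * k + 1 := by rw [hfold, fold]; split_ifs <;> omega
  simp only [hA]
  rcases Nat.eq_zero_or_pos (f p) with hz | hz
  · have hX : ¬ (p = 6 * k + 6 ∨ p = 6 * k + 7) := by
      rintro (rfl | rfl) <;> omega
    refine Or.inl ⟨hX, hz, ?_⟩
    subst hf
    exact map_armNbr_fold_zero (by omega) (by omega) (by omega) hp 
      (fun _ h => h.1 (by rw [hz, Nat.zero_mod])) hz
  refine Or.inr ?_
  by_cases hpr : p = 6 * k + 6
  · refine Or.inr (Or.inr (⟨Or.inl hpr, by rw [hpr, hfr], ?_⟩))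
    subst hf hpr
    rw [map_armNbr_fold_left_of_not (by omega) (by omega) (by simp), hfr, hfr']
    simp
  by_cases hpr' : p = 6 * k + 7
  · refine Or.inr (Or.inr (⟨Or.inr hpr', by rw [hpr', hfr'], ?_⟩))
    subst hf hpr'
    rw [map_armNbr_fold_right_of_not (by omega) (by omega) (by simp), hfr', hfr,
      Multiset.pair_comm]
    simp
  have hX : ¬ (p = 6 * k + 6 ∨ p = 6 * k + 7) := by omega
  have hle : f p ≤ 3 * k + 3 := by rw [hfold, fold]; split_ifs <;> omega
  by_cases h3 : f p % 3 = 0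
  · refine Or.inr (Or.inl ⟨hX, hz, h3, hle, ?_⟩)
    subst hf
    exact map_armNbr_fold_of_not (by omega) (by omega) hp0 hp hpr hpr' hz (Or.inl h3)
  · refine Or.inl ⟨hX, h3, hle, ?_⟩
    subst hf
    exact map_armNbr_fold_one (by omega) (by omega) hp0 hp hpr hpr' hz h3 hpr hpr'

/-- The turn is the letter 0 in X0X; its value `3 * k + 3` is divisible by 3, in accordance with its
degree 2. -/
theorem armNbr_family5 (k p : ℕ) (hp0 : 0 < p) (hp : p < 9 * k + 9) {f : ℕ → ℕ}
    (hf : f = fold (3 * k + 1) (6 * k + 5) (9 * k + 9)) {A : ℕ → Multiset ℕ}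
    (hA : A = fun p => (armNbr (9 * k + 9) (OnesOf 3 f (6 * k + 4) (6 * k + 6)) p).map f) :
    (¬ (p = 6 * k + 4 ∨ p = 6 * k + 6) ∧ f p = 0 ∧ A p = {0, 1}) ∨
      (¬ (p = 6 * k + 4 ∨ p = 6 * k + 6) ∧ f p % 3 ≠ 0 ∧ f p ≤ 3 * k + 1 ∧
        A p = {f p - 1, f p + 1, f p}) ∨
      (¬ (p = 6 * k + 4 ∨ p = 6 * k + 6) ∧ 0 < f p ∧ f p % 3 = 0 ∧ f p ≤ 3 * k + 1 ∧
        A p = {f p - 1, f p + 1}) ∨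
      ((p = 6 * k + 4 ∨ p = 6 * k + 6) ∧ f p = 3 * k + 2 ∧ A p = {3 * k + 1, 3 * k + 3}) ∨
      (¬ (p = 6 * k + 4 ∨ p = 6 * k + 6) ∧ f p = 3 * k + 3 ∧ A p = {3 * k + 2, 3 * k + 2}) := by
  have hfold : ∀ p, f p = fold (3 * k + 1) (6 * k + 5) (9 * k + 9) p := fun p => by rw [hf]
  have hfr : f (6 * k + 4) = 3 * k + 2 := by rw [hfold, fold]; split_ifs <;> omega
  have hfr' : f (6 * k + 6) = 3 * k + 2 := by rw [hfold, fold]; split_ifs <;> omega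
  have hfc : f (6 * k + 5) = 3 * k + 3 := by rw [hfold, fold]; split_ifs <;> omega
  simp only [hA]
  rcases Nat.eq_zero_or_pos (f p) with hz | hz
  · have hX : ¬ (p = 6 * k + 4 ∨ p = 6 * k + 6) := by
      rintro (rfl | rfl) <;> omega
    refine Or.inl ⟨hX, hz, ?_⟩
    subst hf
    exact map_armNbr_fold_zero (by omega) (by omega) (by omega) hp 
      (fun _ h => h.1 (by rw [hz, Nat.zero_mod])) hz
  refine Or.inr ?_
  by_cases hpr : p = 6 * k + 4
  · refine Or.inr (Or.inr (Or.inl ⟨Or.inl hpr, by rw [hpr, hfr], ?_⟩))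
    subst hf hpr
    rw [map_armNbr_fold_of_not (by omega) (by omega) hp0 hp (by omega) (by omega) hz (by simp), hfr]
    simp
  by_cases hpr' : p = 6 * k + 6
  · refine Or.inr (Or.inr (Or.inl ⟨Or.inr hpr', by rw [hpr', hfr'], ?_⟩))
    subst hf hpr'
    rw [map_armNbr_fold_right_of_not (by omega) (by omega) (by simp), hfr', hfc,
      Multiset.pair_comm]
    simp
  have hX : ¬ (p = 6 * k + 4 ∨ p = 6 * k + 6) := by omega
  by_cases hpc : p = 6 * k + 5
  · refine Or.inr (Or.inr (Or.inr ⟨hX, by rw [hpc, hfc], ?_⟩))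
    subst hf hpc
    rw [map_armNbr_fold_left_of_not (by omega) (by omega) (Or.inl (by rw [hfc]; omega)), hfc, hfr']
    simp
  have hle : f p ≤ 3 * k + 1 := by rw [hfold, fold]; split_ifs <;> omega
  by_cases h3 : f p % 3 = 0
  · refine Or.inr (Or.inl ⟨hX, hz, h3, hle, ?_⟩)
    subst hf
    exact map_armNbr_fold_of_not (by omega) (by omega) hp0 hp hpc hpr' hz (Or.inl h3)
  · refine Or.inl ⟨hX, h3, hle, ?_⟩
    subst hf
    exact map_armNbr_fold_one (by omega) (by omega) hp0 hp hpc hpr' hz h3 hpr hpr'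

/-! ### The criterion combining all phases -/

theorem map_posNbr {α : Type*} (l r r' : ℕ) (L : ℕ → Prop) {p : ℕ} (f : ℕ → α) (hp : 0 < p) :
    (posNbr l r r' L p).map f =
      (armNbr l L p).map f + (if p = r ∨ p = r' then {f 0} else 0) := by
  rw [posNbr, if_neg hp.ne', Multiset.map_add, map_ite_zero, Multiset.map_singleton]

theorem cons_pair_comm {α : Type*} (a b c : α) :
    (a ::ₘ b ::ₘ {c} : Multiset α) = {a, c, b} :=
  congrArg (a ::ₘ ·) (Multiset.pair_comm b c)

theorem map_posNbr_zero {α : Type*} (l r r' : ℕ) (L : ℕ → Prop) (f : ℕ → α) :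
    (posNbr l r r' L 0).map f = {f 1, f r, f r} := by
  simp [posNbr]

/-- The graph encoded by a string is a long-refinement graph if the positions are folded by `f`,
the values of `f` are separated one by one in increasing order, starting from the partition given
by `b`, and the positions are then separated one by one in increasing order. Here, `A p` and `T p`
list the values of `f` at the neighbours of a vertex at position `p`, excluding and including the
edges due to the letter `X`. -/
theorem Layout.isLongRefinement_of_fold {Ξ : List Letter} {r r' : ℕ} {L : ℕ → Prop}
    (h : Layout Ξ r r' L) {β : Type*} {l t n q₀ : ℕ} (b : ℕ → β) (f : ℕ → ℕ) (A T : ℕ → Multiset ℕ)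
    (hl : Ξ.length = l) (hlen : t + n + (r + 1 - q₀) = l - 1) (hq₀ : q₀ ≤ r) (hrr : f r = f r')
    (hA : ∀ p, A p = (armNbr l L p).map f) (hT₀ : T 0 = {f 1, f r, f r})
    (hT : ∀ p, 0 < p → T p = A p + (if p = r ∨ p = r' then {f 0} else 0))
    (ht : t = 0 ∧ (∀ i j, b i = b j) ∨
      t = 1 ∧ ∀ p q, p < l → q < l → (b (f p) = b (f q) ↔ (T p).card = (T q).card))
    (heq : ∀ p q, p < l → q < l → p < q → f p = f q →
      (T p).map (fun i => (b i, min i (n - 1))) = (T q).map (fun i => (b i, min i (n - 1))))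
    (hlt : ∀ p q, p < l → q < l → 0 < f p → f p < f q → b (f p) = b (f q) →
      (T p).map b = (T q).map b ∧ (∀ i ∈ T p, f p ≤ i + 1) ∧ (∀ i ∈ T q, f p ≤ i + 1) ∧
        (T p).count (f p - 1) ≠ (T q).count (f p - 1))
    (hzero : ∀ p q, p < l → q < l → f p = 0 → 0 < f q → b 0 = b (f q) →
      (T p).map b ≠ (T q).map b)
    (hend : ∀ p q, p < l → q < l → n ≤ f p → f p < f q → b (f p) ≠ b (f q))
    (hsing : ∀ p q, p < q₀ → q < l → f p = f q → p = q)
    (harm : ∀ p q, q₀ < p → p < q → q < l → f p = f q →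
      A p = A q ∧ (p = r ∨ p = r' ↔ q = r ∨ q = r'))
    (hone : f 1 ≠ f r) (hhead : q₀ = 0 → ∀ p, 0 < p → p < l → f 0 = f p → T 0 ≠ T p)
    (hlast : ∀ p q, r < p → p < q → q < l → f p ≠ f q) :
    IsLongRefinement (encodedGraph Ξ) := by
  subst hl
  have hTf : ∀ p, T p = (posNbr Ξ.length r r' L p).map f := by
    intro p
    rcases Nat.eq_zero_or_pos p with rfl | hp
    · rw [hT₀, map_posNbr_zero]
    · rw [hT p hp, hA, map_posNbr _ _ _ _ _ hp]
  have hstart : partition (encodedGraph Ξ) t = Setoid.ker fun v => b (f v.1) := by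
    rcases ht with ⟨rfl, hb⟩ | ⟨rfl, hb⟩
    · rw [partition_zero]
      ext v w
      exact iff_of_true trivial (hb _ _)
    · rw [partition_one]
      ext v w
      simp only [Setoid.ker_def, hb _ _ v.1.2 w.1.2, hTf, Multiset.card_map, h.degree_eq]
  simp only [hTf] at heq hlt hzero hhead
  simp only [hA] at harm
  have hfold := h.partition_eq_fold b f hstart hrr heq hlt hzero hend
  have hpairs := h.partition_eq_pairs f hq₀ hfold hrr hsing harm hone hhead hlast
  rw [hlen] at hpairs
  exact h.isLongRefinement hpairs

/-! ### Verification of the criterion for each family -/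

theorem isLongRefinement_family1 (k : ℕ) : IsLongRefinement (encodedGraph (family1 k)) := by
  have h := layout_family1 k
  obtain ⟨f, hf⟩ : ∃ f, f = fold (k + 1) (2 * k + 4) (3 * k + 7) := ⟨_, rfl⟩
  have hfold : ∀ p, f p = fold (k + 1) (2 * k + 4) (3 * k + 7) p := fun p => by rw [hf]
  rw [← hf] at h
  obtain ⟨A, hA⟩ : ∃ A : ℕ → Multiset ℕ, A = fun p => (armNbr (3 * k + 7)
    (OnesOf 0 f (2 * k + 3) (2 * k + 5)) p).map f := ⟨_, rfl⟩
  obtain ⟨T, hT₀, hT⟩ : ∃ T : ℕ → Multiset ℕ, T 0 = {f 1, f (2 * k + 3), f (2 * k + 3)} ∧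
      ∀ p, 0 < p → T p = A p + (if p = 2 * k + 3 ∨ p = 2 * k + 5 then {f 0} else 0) :=
    ⟨fun p => if p = 0 then _ else _, if_pos rfl, fun p hp => if_neg hp.ne'⟩
  have hf0 : f 0 = k + 1 := by rw [hfold, fold]; split_ifs <;> omega
  have hf1 : f 1 = k := by rw [hfold, fold]; split_ifs <;> omega
  have hfr : f (2 * k + 3) = k + 1 := by rw [hfold, fold]; split_ifs <;> omega
  have hfr' : f (2 * k + 5) = k + 1 := by rw [hfold, fold]; split_ifs <;> omega
  rw [hf1, hfr] at hT₀
  rw [hf0] at hT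
  have arm := fun p h0 hp => armNbr_family1 k p h0 hp hf hA
  -- Position 0 and the letters X share the value `k + 1`; their rows differ only in `k + 1` against
  -- `k + 2`, which truncation at `n - 1 = k + 1` hides.
  have tab : ∀ p < 3 * k + 7, (p = 0 ∧ f p = k + 1 ∧ T p = {k, k + 1, k + 1}) ∨
      (0 < p ∧ f p = 0 ∧ T p = {0, 1}) ∨
      (0 < p ∧ (0 < f p ∧ f p ≤ k) ∧ T p = {f p - 1, f p + 1, f p}) ∨
      (0 < p ∧ f p = k + 1 ∧ T p = {k, k + 2, k + 1}) ∨
      (0 < p ∧ f p = k + 2 ∧ T p = {k + 1, k + 1, k + 2}) := by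
    intro p hp
    rcases Nat.eq_zero_or_pos p with rfl | hp0
    · exact Or.inl ⟨rfl, hf0, hT₀⟩
    rcases arm p hp0 hp with
      ⟨hX, h1, h2⟩ | ⟨hX, h1, h1', h2⟩ | ⟨hX, h1, h2⟩ | ⟨hX, h1, h2⟩
    · have hTp := hT p hp0
      rw [if_neg hX, h2, add_zero] at hTp
      exact Or.inr (Or.inl ⟨hp0, h1, hTp⟩)
    · have hTp := hT p hp0
      rw [if_neg hX, h2, add_zero] at hTp
      exact Or.inr (Or.inr (Or.inl ⟨hp0, ⟨h1, h1'⟩, hTp⟩))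
    · have hTp := hT p hp0
      rw [if_pos hX, h2, Multiset.insert_eq_cons, Multiset.cons_add, Multiset.singleton_add] at hTp
      exact Or.inr (Or.inr (Or.inr (Or.inl ⟨hp0, h1, hTp⟩)))
    · have hTp := hT p hp0
      rw [if_neg hX, h2, add_zero] at hTp
      exact Or.inr (Or.inr (Or.inr (Or.inr (⟨hp0, h1, hTp⟩))))
  refine h.isLongRefinement_of_fold (t := 0) (n := k + 2) (q₀ := 0) (fun _ => ()) f A T
    (length_family1 k) (by omega) (by omega) (by rw [hfr, hfr']) (fun p => by rw [hA])
    (by rw [hT₀, hf1, hfr]) (by rwa [hf0]) ?_ ?_ ?_ ?_ ?_ ?_ ?_ ?_ ?_ ?_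
  · exact Or.inl ⟨rfl, fun _ _ => rfl⟩
  · intro p q hp hq _ hpq
    rcases tab p hp with hp | hp | hp | hp | hp <;>
    rcases tab q hq with hq | hq | hq | hq | hq <;>
    obtain ⟨hp0, hp1, hp2⟩ := hp <;>
    obtain ⟨hq0, hq1, hq2⟩ := hq <;>
    first
      | omega
      | (rw [hp2, hq2, hpq]; done)
      | (rw [hp2, hq2] <;> simp [hpq, hq1]; done)
      | (rw [hp2, hq2] <;> simp [← hpq, hp1])
  · intro p q hp hq h0 hpq _
    rcases tab p hp with hp | hp | hp | hp | hp <;>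
    rcases tab q hq with hq | hq | hq | hq | hq <;>
    obtain ⟨hp0, hp1, hp2⟩ := hp <;>
    obtain ⟨hq0, hq1, hq2⟩ := hq <;>
    first
      | omega
      | (rw [hp2, hq2]; simp [Multiset.count_cons, Multiset.count_singleton] <;>
          first | omega | (split_ifs <;> omega))
  · intro p q hp hq h0 hpq _
    rcases tab p hp with hp | hp | hp | hp | hp <;>
    rcases tab q hq with hq | hq | hq | hq | hq <;>
    obtain ⟨hp0, hp1, hp2⟩ := hp <;>
    obtain ⟨hq0, hq1, hq2⟩ := hq <;>
    first | omega | (rw [hp2, hq2]; simp)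
  · intro p q hp hq hn hpq
    rcases tab q hq with hq | hq | hq | hq | hq <;>
    obtain ⟨hq0, hq1, hq2⟩ := hq <;>
    omega
  · intro p q hp
    omega
  · intro p q hp hpq hq hf
    rcases arm p (by omega) (by omega) with
      ⟨hX, h1, h2⟩ | ⟨hX, h1, h1', h2⟩ | ⟨hX, h1, h2⟩ | ⟨hX, h1, h2⟩ <;>
    rcases arm q (by omega) hq with
      ⟨hX', h3, h4⟩ | ⟨hX', h3, h3', h4⟩ | ⟨hX', h3, h4⟩ | ⟨hX', h3, h4⟩ <;>
    first
      | omega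
      | exact ⟨by rw [h2, h4, hf], by tauto⟩
      | exact ⟨by rw [h2, h4], by tauto⟩
  · omega
  · intro _ p h0 hpl hf heq
    rw [hT₀] at heq
    -- Once all values are separated, position 0 sees `k + 1` twice, but an X sees it once.
    have hc := congrArg (Multiset.count (k + 1)) heq
    rcases tab p hpl with hp | hp | hp | hp | hp <;>
    obtain ⟨hp0, hp1, hp2⟩ := hp <;>
    first
      | omega
      | (rw [hp2] at hc; simp at hc)
  · intro p q hp hpq hq
    simp only [hfold, fold]
    split_ifs <;> omega

theorem isLongRefinement_family2 (k : ℕ) : IsLongRefinement (encodedGraph (family2 k)) := by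
  have h := layout_family2 k
  obtain ⟨f, hf⟩ : ∃ f, f = fold (k + 3) (2 * k + 5) (3 * k + 8) := ⟨_, rfl⟩
  have hfold : ∀ p, f p = fold (k + 3) (2 * k + 5) (3 * k + 8) p := fun p => by rw [hf]
  rw [← hf] at h
  obtain ⟨A, hA⟩ : ∃ A : ℕ → Multiset ℕ, A = fun p => (armNbr (3 * k + 8)
    (OnesOf 0 f (2 * k + 5) (2 * k + 6)) p).map f := ⟨_, rfl⟩
  obtain ⟨T, hT₀, hT⟩ : ∃ T : ℕ → Multiset ℕ, T 0 = {f 1, f (2 * k + 5), f (2 * k + 5)} ∧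
      ∀ p, 0 < p → T p = A p + (if p = 2 * k + 5 ∨ p = 2 * k + 6 then {f 0} else 0) :=
    ⟨fun p => if p = 0 then _ else _, if_pos rfl, fun p hp => if_neg hp.ne'⟩
  have hf0 : f 0 = k + 3 := by rw [hfold, fold]; split_ifs <;> omega
  have hf1 : f 1 = k + 2 := by rw [hfold, fold]; split_ifs <;> omega
  have hfr : f (2 * k + 5) = k + 1 := by rw [hfold, fold]; split_ifs <;> omega
  have hfr' : f (2 * k + 6) = k + 1 := by rw [hfold, fold]; split_ifs <;> omega
  rw [hf1, hfr] at hT₀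
  rw [hf0] at hT
  have arm := fun p h0 hp => armNbr_family2 k p h0 hp hf hA
  have tab : ∀ p < 3 * k + 8, (p = 0 ∧ f p = k + 3 ∧ T p = {k + 2, k + 1, k + 1}) ∨
      (0 < p ∧ f p = 0 ∧ T p = {0, 1}) ∨
      (0 < p ∧ (0 < f p ∧ f p ≤ k + 2) ∧ T p = {f p - 1, f p + 1, f p}) ∨
      (0 < p ∧ f p = k + 1 ∧ T p = {k, k + 3, k + 1}) := by
    intro p hp
    rcases Nat.eq_zero_or_pos p with rfl | hp0
    · exact Or.inl ⟨rfl, hf0, hT₀⟩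
    rcases arm p hp0 hp with
      ⟨hX, h1, h2⟩ | ⟨hX, h1, h1', h2⟩ | ⟨hX, h1, h2⟩
    · have hTp := hT p hp0
      rw [if_neg hX, h2, add_zero] at hTp
      exact Or.inr (Or.inl ⟨hp0, h1, hTp⟩)
    · have hTp := hT p hp0
      rw [if_neg hX, h2, add_zero] at hTp
      exact Or.inr (Or.inr (Or.inl ⟨hp0, ⟨h1, h1'⟩, hTp⟩))
    · have hTp := hT p hp0
      rw [if_pos hX, h2, Multiset.insert_eq_cons, Multiset.cons_add, Multiset.singleton_add,
        cons_pair_comm] at hTp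
      exact Or.inr (Or.inr (Or.inr (⟨hp0, h1, hTp⟩)))
  -- The first layer exceeds the others by two positions: 0 and 1 carry the unique values `k + 3`
  -- and `k + 2`, whence `q₀ = 2`.
  refine h.isLongRefinement_of_fold (t := 0) (n := k + 3) (q₀ := 2) (fun _ => ()) f A T
    (length_family2 k) (by omega) (by omega) (by rw [hfr, hfr']) (fun p => by rw [hA])
    (by rw [hT₀, hf1, hfr]) (by rwa [hf0]) ?_ ?_ ?_ ?_ ?_ ?_ ?_ ?_ ?_ ?_
  · exact Or.inl ⟨rfl, fun _ _ => rfl⟩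
  · intro p q hp hq _ hpq
    rcases tab p hp with hp | hp | hp | hp <;>
    rcases tab q hq with hq | hq | hq | hq <;>
    obtain ⟨hp0, hp1, hp2⟩ := hp <;>
    obtain ⟨hq0, hq1, hq2⟩ := hq <;>
    first
      | omega
      | (rw [hp2, hq2, hpq]; done)
      | (rw [hp2, hq2] <;> simp [hpq, hq1]; done)
      | (rw [hp2, hq2] <;> simp [← hpq, hp1])
  · intro p q hp hq h0 hpq _
    rcases tab p hp with hp | hp | hp | hp <;>
    rcases tab q hq with hq | hq | hq | hq <;>
    obtain ⟨hp0, hp1, hp2⟩ := hp <;>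
    obtain ⟨hq0, hq1, hq2⟩ := hq <;>
    first
      | omega
      | (rw [hp2, hq2]; simp [Multiset.count_cons, Multiset.count_singleton] <;>
          first | omega | (split_ifs <;> omega))
  · intro p q hp hq h0 hpq _
    rcases tab p hp with hp | hp | hp | hp <;>
    rcases tab q hq with hq | hq | hq | hq <;>
    obtain ⟨hp0, hp1, hp2⟩ := hp <;>
    obtain ⟨hq0, hq1, hq2⟩ := hq <;>
    first | omega | (rw [hp2, hq2]; simp)
  · intro p q hp hq hn hpq
    rcases tab q hq with hq | hq | hq | hq <;>
    obtain ⟨hq0, hq1, hq2⟩ := hq <;>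
    omega
  · intro p q hp hq
    simp only [hfold, fold]
    split_ifs <;> omega
  · intro p q hp hpq hq hf
    -- The other position of value `k + 1` is `q₀` itself, the first one to be separated, for which
    -- no agreement is required.
    have hlow : ∀ p, 2 < p → p < 3 * k + 8 → f p = k + 1 → p = 2 * k + 5 ∨ p = 2 * k + 6 := by
      intro p
      simp only [hfold, fold]
      split_ifs <;> omega
    have hp' := hlow p hp (by omega)
    have hq' := hlow q (by omega) hq
    rcases arm p (by omega) (by omega) with
      ⟨hX, h1, h2⟩ | ⟨hX, h1, h1', h2⟩ | ⟨hX, h1, h2⟩ <;>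
    rcases arm q (by omega) hq with
      ⟨hX', h3, h4⟩ | ⟨hX', h3, h3', h4⟩ | ⟨hX', h3, h4⟩ <;>
    first
      | omega
      | exact ⟨by rw [h2, h4, hf], by tauto⟩
      | exact ⟨by rw [h2, h4], by tauto⟩
  · omega
  · intro h0
    omega
  · intro p q hp hpq hq
    simp only [hfold, fold]
    split_ifs <;> omega

theorem isLongRefinement_family3 (k : ℕ) : IsLongRefinement (encodedGraph (family3 k)) := by
  have h := layout_family3 k
  obtain ⟨f, hf⟩ : ∃ f, f = fold (k + 1) (2 * k + 4) (3 * k + 8) := ⟨_, rfl⟩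
  have hfold : ∀ p, f p = fold (k + 1) (2 * k + 4) (3 * k + 8) p := fun p => by rw [hf]
  rw [← hf] at h
  obtain ⟨A, hA⟩ : ∃ A : ℕ → Multiset ℕ, A = fun p => (armNbr (3 * k + 8)
    (OnesOf 0 f (2 * k + 4) (2 * k + 5)) p).map f := ⟨_, rfl⟩
  obtain ⟨T, hT₀, hT⟩ : ∃ T : ℕ → Multiset ℕ, T 0 = {f 1, f (2 * k + 4), f (2 * k + 4)} ∧
      ∀ p, 0 < p → T p = A p + (if p = 2 * k + 4 ∨ p = 2 * k + 5 then {f 0} else 0) :=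
    ⟨fun p => if p = 0 then _ else _, if_pos rfl, fun p hp => if_neg hp.ne'⟩
  have hf0 : f 0 = k + 1 := by rw [hfold, fold]; split_ifs <;> omega
  have hf1 : f 1 = k := by rw [hfold, fold]; split_ifs <;> omega
  have hfr : f (2 * k + 4) = k + 2 := by rw [hfold, fold]; split_ifs <;> omega
  have hfr' : f (2 * k + 5) = k + 2 := by rw [hfold, fold]; split_ifs <;> omega
  rw [hf1, hfr] at hT₀
  rw [hf0] at hT
  have arm := fun p h0 hp => armNbr_family3 k p h0 hp hf hA
  have tab : ∀ p < 3 * k + 8, (p = 0 ∧ f p = k + 1 ∧ T p = {k, k + 2, k + 2}) ∨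
      (0 < p ∧ f p = 0 ∧ T p = {0, 1}) ∨
      (0 < p ∧ (0 < f p ∧ f p ≤ k + 1) ∧ T p = {f p - 1, f p + 1, f p}) ∨
      (0 < p ∧ f p = k + 2 ∧ T p = {k + 1, k + 1, k + 2}) := by
    intro p hp
    rcases Nat.eq_zero_or_pos p with rfl | hp0
    · exact Or.inl ⟨rfl, hf0, hT₀⟩
    rcases arm p hp0 hp with
      ⟨hX, h1, h2⟩ | ⟨hX, h1, h1', h2⟩ | ⟨hX, h1, h2⟩
    · have hTp := hT p hp0
      rw [if_neg hX, h2, add_zero] at hTp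
      exact Or.inr (Or.inl ⟨hp0, h1, hTp⟩)
    · have hTp := hT p hp0
      rw [if_neg hX, h2, add_zero] at hTp
      exact Or.inr (Or.inr (Or.inl ⟨hp0, ⟨h1, h1'⟩, hTp⟩))
    · have hTp := hT p hp0
      rw [if_pos hX, h2, Multiset.insert_eq_cons, Multiset.cons_add, Multiset.singleton_add,
        cons_pair_comm] at hTp
      exact Or.inr (Or.inr (Or.inr (⟨hp0, h1, hTp⟩)))
  refine h.isLongRefinement_of_fold (t := 0) (n := k + 2) (q₀ := 0) (fun _ => ()) f A T
    (length_family3 k) (by omega) (by omega) (by rw [hfr, hfr']) (fun p => by rw [hA])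
    (by rw [hT₀, hf1, hfr]) (by rwa [hf0]) ?_ ?_ ?_ ?_ ?_ ?_ ?_ ?_ ?_ ?_
  · exact Or.inl ⟨rfl, fun _ _ => rfl⟩
  · intro p q hp hq _ hpq
    rcases tab p hp with hp | hp | hp | hp <;>
    rcases tab q hq with hq | hq | hq | hq <;>
    obtain ⟨hp0, hp1, hp2⟩ := hp <;>
    obtain ⟨hq0, hq1, hq2⟩ := hq <;>
    first
      | omega
      | (rw [hp2, hq2, hpq]; done)
      | (rw [hp2, hq2] <;> simp [hpq, hq1]; done)
      | (rw [hp2, hq2] <;> simp [← hpq, hp1])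
  · intro p q hp hq h0 hpq _
    rcases tab p hp with hp | hp | hp | hp <;>
    rcases tab q hq with hq | hq | hq | hq <;>
    obtain ⟨hp0, hp1, hp2⟩ := hp <;>
    obtain ⟨hq0, hq1, hq2⟩ := hq <;>
    first
      | omega
      | (rw [hp2, hq2]; simp [Multiset.count_cons, Multiset.count_singleton] <;>
          first | omega | (split_ifs <;> omega))
  · intro p q hp hq h0 hpq _
    rcases tab p hp with hp | hp | hp | hp <;>
    rcases tab q hq with hq | hq | hq | hq <;>
    obtain ⟨hp0, hp1, hp2⟩ := hp <;>
    obtain ⟨hq0, hq1, hq2⟩ := hq <;>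
    first | omega | (rw [hp2, hq2]; simp)
  · intro p q hp hq hn hpq
    rcases tab q hq with hq | hq | hq | hq <;>
    obtain ⟨hq0, hq1, hq2⟩ := hq <;>
    omega
  · intro p q hp
    omega
  · intro p q hp hpq hq hf
    rcases arm p (by omega) (by omega) with
      ⟨hX, h1, h2⟩ | ⟨hX, h1, h1', h2⟩ | ⟨hX, h1, h2⟩ <;>
    rcases arm q (by omega) hq with
      ⟨hX', h3, h4⟩ | ⟨hX', h3, h3', h4⟩ | ⟨hX', h3, h4⟩ <;>
    first
      | omega
      | exact ⟨by rw [h2, h4, hf], by tauto⟩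
      | exact ⟨by rw [h2, h4], by tauto⟩
  · omega
  · intro _ p h0 hpl hf heq
    rw [hT₀] at heq
    -- Position 0 sees the value `k + 2` of the letters X twice; the other positions of value `k +
    -- 1` see it once.
    have hc := congrArg (Multiset.count (k + 2)) heq
    rcases tab p hpl with hp | hp | hp | hp <;>
    obtain ⟨hp0, hp1, hp2⟩ := hp <;>
    first
      | omega
      | (rw [hp2] at hc; simp [← hf, hf0] at hc)
  · intro p q hp hpq hq
    simp only [hfold, fold]
    split_ifs <;> omega

set_option maxHeartbeats 1000000 in
theorem isLongRefinement_family4 (k : ℕ) : IsLongRefinement (encodedGraph (family4 k)) := by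
  have h := layout_family4 k
  obtain ⟨f, hf⟩ : ∃ f, f = fold (3 * k + 4) (6 * k + 6) (9 * k + 9) := ⟨_, rfl⟩
  have hfold : ∀ p, f p = fold (3 * k + 4) (6 * k + 6) (9 * k + 9) p := fun p => by rw [hf]
  rw [← hf] at h
  obtain ⟨A, hA⟩ : ∃ A : ℕ → Multiset ℕ, A = fun p => (armNbr (9 * k + 9)
    (OnesOf 3 f (6 * k + 6) (6 * k + 7)) p).map f := ⟨_, rfl⟩
  obtain ⟨T, hT₀, hT⟩ : ∃ T : ℕ → Multiset ℕ, T 0 = {f 1, f (6 * k + 6), f (6 * k + 6)} ∧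
      ∀ p, 0 < p → T p = A p + (if p = 6 * k + 6 ∨ p = 6 * k + 7 then {f 0} else 0) :=
    ⟨fun p => if p = 0 then _ else _, if_pos rfl, fun p hp => if_neg hp.ne'⟩
  have hf0 : f 0 = 3 * k + 4 := by rw [hfold, fold]; split_ifs <;> omega
  have hf1 : f 1 = 3 * k + 3 := by rw [hfold, fold]; split_ifs <;> omega
  have hfr : f (6 * k + 6) = 3 * k + 1 := by rw [hfold, fold]; split_ifs <;> omega
  have hfr' : f (6 * k + 7) = 3 * k + 1 := by rw [hfold, fold]; split_ifs <;> omega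
  rw [hf1, hfr] at hT₀
  rw [hf0] at hT
  obtain ⟨b, hb⟩ : ∃ b : ℕ → Bool, ∀ i, b i = decide (i % 3 = 0) := ⟨_, fun _ => rfl⟩
  have hbt : ∀ i, i % 3 = 0 → b i = true := fun i hi => by rw [hb, hi]; rfl
  have hbf : ∀ i, i % 3 ≠ 0 → b i = false := fun i hi => by rw [hb, decide_eq_false hi]
  have hb0 : b (3 * k) = true := hbt _ (by omega)
  have hb1 : b (3 * k + 1) = false := hbf _ (by omega)
  have hb2 : b (3 * k + 2) = false := hbf _ (by omega)
  have hb3 : b (3 * k + 3) = true := hbt _ (by omega)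
  have hb4 : b (3 * k + 4) = false := hbf _ (by omega)
  have arm := fun p h0 hp => armNbr_family4 k p h0 hp hf hA
  have tab : ∀ p < 9 * k + 9, (p = 0 ∧ f p = 3 * k + 4 ∧ T p = {3 * k + 3, 3 * k + 1, 3 * k + 1} ∧
        (T p).map b = {true, false, false}) ∨
      (0 < p ∧ f p = 0 ∧ T p = {0, 1} ∧
        (T p).map b = {true, false}) ∨
      (0 < p ∧ (f p % 3 ≠ 0 ∧ f p ≤ 3 * k + 3) ∧ T p = {f p - 1, f p + 1, f p} ∧
        (T p).map b = {true, false, false}) ∨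
      (0 < p ∧ (0 < f p ∧ f p % 3 = 0 ∧ f p ≤ 3 * k + 3) ∧ T p = {f p - 1, f p + 1} ∧
        (T p).map b = {false, false}) ∨
      (0 < p ∧ f p = 3 * k + 1 ∧ T p = {3 * k, 3 * k + 4, 3 * k + 1} ∧
        (T p).map b = {true, false, false}) := by
    intro p hp
    rcases Nat.eq_zero_or_pos p with rfl | hp0
    · exact Or.inl ⟨rfl, hf0, hT₀, by
        rw [hT₀]; simp [hb3, hb1]⟩
    rcases arm p hp0 hp with
      ⟨hX, h1, h2⟩ | ⟨hX, h1, h1', h2⟩ | ⟨hX, h1, h1', h1'', h2⟩ | ⟨hX, h1, h2⟩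
    · have hTp := hT p hp0
      rw [if_neg hX, h2, add_zero] at hTp
      exact Or.inr (Or.inl ⟨hp0, h1, hTp, by
        rw [hTp]; simp [hbt 0 rfl, hbf 1 (by norm_num)]⟩)
    · have hTp := hT p hp0
      rw [if_neg hX, h2, add_zero] at hTp
      exact Or.inr (Or.inr (Or.inl ⟨hp0, ⟨h1, h1'⟩, hTp, by
        rw [hTp]; rcases (by omega : f p % 3 = 1 ∨ f p % 3 = 2) with h3 | h3
        · simp [hbf (f p) h1, hbt (f p - 1) (by omega), hbf (f p + 1) (by omega)]
        · simp [hbf (f p) h1, hbf (f p - 1) (by omega), hbt (f p + 1) (by omega),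
            Multiset.cons_swap true]⟩))
    · have hTp := hT p hp0
      rw [if_neg hX, h2, add_zero] at hTp
      exact Or.inr (Or.inr (Or.inr (Or.inl ⟨hp0, ⟨h1, h1', h1''⟩, hTp, by
        rw [hTp]; simp [hbf (f p - 1) (by omega), hbf (f p + 1) (by omega)]⟩)))
    · have hTp := hT p hp0
      rw [if_pos hX, h2, Multiset.insert_eq_cons, Multiset.cons_add, Multiset.singleton_add,
        cons_pair_comm] at hTp
      exact Or.inr (Or.inr (Or.inr (Or.inr (⟨hp0, h1, hTp, by
        rw [hTp]; simp [hb0, hb4, hb1] <;> decide⟩))))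
  -- The degree round already separates the two largest values `3 * k + 3` and `3 * k + 4`, so `n`
  -- stops short of them. The values at positions 0, 1 and 2 occur nowhere else.
  refine h.isLongRefinement_of_fold (t := 1) (n := 3 * k + 3) (q₀ := 3) b f A T
    (length_family4 k) (by omega) (by omega) (by rw [hfr, hfr']) (fun p => by rw [hA])
    (by rw [hT₀, hf1, hfr]) (by rwa [hf0]) ?_ ?_ ?_ ?_ ?_ ?_ ?_ ?_ ?_ ?_
  · refine Or.inr ⟨rfl, fun p q hp hq => ?_⟩
    have hcard : ∀ p < 9 * k + 9, (T p).card = if f p % 3 = 0 then 2 else 3 := by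
      intro p hp
      rcases tab p hp with hp | hp | hp | hp | hp <;>
      obtain ⟨hp0, hp1, hp2, hp3⟩ := hp <;>
      first
        | (rw [if_pos (by omega), hp2]; rfl)
        | (rw [if_neg (by omega), hp2]; rfl)
    rw [hcard p hp, hcard q hq, hb, hb, decide_eq_decide]
    split_ifs <;> simp_all
  · intro p q hp hq _ hpq
    rcases tab p hp with hp | hp | hp | hp | hp <;>
    rcases tab q hq with hq | hq | hq | hq | hq <;>
    obtain ⟨hp0, hp1, hp2, hp3⟩ := hp <;>
    obtain ⟨hq0, hq1, hq2, hq3⟩ := hq <;>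
    first
      | omega
      | (rw [hp2, hq2, hpq]; done)
      | (rw [hp2, hq2] <;> simp [hpq, hq1, hb3, hb1, hb4, hb0, hb2]; done)
      | (rw [hp2, hq2] <;> simp [← hpq, hp1, hb3, hb1, hb4, hb0, hb2])
  · intro p q hp hq h0 hpq hbpq
    rw [hb, hb, decide_eq_decide] at hbpq
    rcases tab p hp with hp | hp | hp | hp | hp <;>
    rcases tab q hq with hq | hq | hq | hq | hq <;>
    obtain ⟨hp0, hp1, hp2, hp3⟩ := hp <;>
    obtain ⟨hq0, hq1, hq2, hq3⟩ := hq <;>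
    first
      | omega
      | (rw [hp3, hq3, hp2, hq2]; simp [Multiset.count_cons, Multiset.count_singleton] <;>
          first | omega | (split_ifs <;> omega))
  · intro p q hp hq h0 hpq hbpq
    rw [hb, hb, decide_eq_decide] at hbpq
    rcases tab p hp with hp | hp | hp | hp | hp <;>
    rcases tab q hq with hq | hq | hq | hq | hq <;>
    obtain ⟨hp0, hp1, hp2, hp3⟩ := hp <;>
    obtain ⟨hq0, hq1, hq2, hq3⟩ := hq <;>
    first | omega | (rw [hp3, hq3]; decide)
  · intro p q hp hq hn hpq hbpq
    rw [hb, hb, decide_eq_decide] at hbpq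
    rcases tab q hq with hq | hq | hq | hq | hq <;>
    obtain ⟨hq0, hq1, hq2, hq3⟩ := hq <;>
    omega
  · intro p q hp hq
    simp only [hfold, fold]
    split_ifs <;> omega
  · intro p q hp hpq hq hf
    have hlow : ∀ p, 3 < p → p < 9 * k + 9 → f p = 3 * k + 1 → p = 6 * k + 6 ∨ p = 6 * k + 7 := by
      intro p
      simp only [hfold, fold]
      split_ifs <;> omega
    have hp' := hlow p hp (by omega)
    have hq' := hlow q (by omega) hq
    rcases arm p (by omega) (by omega) with
      ⟨hX, h1, h2⟩ | ⟨hX, h1, h1', h2⟩ | ⟨hX, h1, h1', h1'', h2⟩ | ⟨hX, h1, h2⟩ <;>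
    rcases arm q (by omega) hq with
      ⟨hX', h3, h4⟩ | ⟨hX', h3, h3', h4⟩ | ⟨hX', h3, h3', h3'', h4⟩ | ⟨hX', h3, h4⟩ <;>
    first
      | omega
      | exact ⟨by rw [h2, h4, hf], by tauto⟩
      | exact ⟨by rw [h2, h4], by tauto⟩
  · omega
  · intro h0
    omega
  · intro p q hp hpq hq
    simp only [hfold, fold]
    split_ifs <;> omega

set_option maxHeartbeats 1000000 in
theorem isLongRefinement_family5 (k : ℕ) : IsLongRefinement (encodedGraph (family5 k)) := by
  have h := layout_family5 k
  obtain ⟨f, hf⟩ : ∃ f, f = fold (3 * k + 1) (6 * k + 5) (9 * k + 9) := ⟨_, rfl⟩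
  have hfold : ∀ p, f p = fold (3 * k + 1) (6 * k + 5) (9 * k + 9) p := fun p => by rw [hf]
  rw [← hf] at h
  obtain ⟨A, hA⟩ : ∃ A : ℕ → Multiset ℕ, A = fun p => (armNbr (9 * k + 9)
    (OnesOf 3 f (6 * k + 4) (6 * k + 6)) p).map f := ⟨_, rfl⟩
  obtain ⟨T, hT₀, hT⟩ : ∃ T : ℕ → Multiset ℕ, T 0 = {f 1, f (6 * k + 4), f (6 * k + 4)} ∧
      ∀ p, 0 < p → T p = A p + (if p = 6 * k + 4 ∨ p = 6 * k + 6 then {f 0} else 0) :=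
    ⟨fun p => if p = 0 then _ else _, if_pos rfl, fun p hp => if_neg hp.ne'⟩
  have hf0 : f 0 = 3 * k + 1 := by rw [hfold, fold]; split_ifs <;> omega
  have hf1 : f 1 = 3 * k := by rw [hfold, fold]; split_ifs <;> omega
  have hfr : f (6 * k + 4) = 3 * k + 2 := by rw [hfold, fold]; split_ifs <;> omega
  have hfr' : f (6 * k + 6) = 3 * k + 2 := by rw [hfold, fold]; split_ifs <;> omega
  rw [hf1, hfr] at hT₀
  rw [hf0] at hT
  obtain ⟨b, hb⟩ : ∃ b : ℕ → Bool, ∀ i, b i = decide (i % 3 = 0) := ⟨_, fun _ => rfl⟩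
  have hbt : ∀ i, i % 3 = 0 → b i = true := fun i hi => by rw [hb, hi]; rfl
  have hbf : ∀ i, i % 3 ≠ 0 → b i = false := fun i hi => by rw [hb, decide_eq_false hi]
  have hb0 : b (3 * k) = true := hbt _ (by omega)
  have hb1 : b (3 * k + 1) = false := hbf _ (by omega)
  have hb2 : b (3 * k + 2) = false := hbf _ (by omega)
  have hb3 : b (3 * k + 3) = true := hbt _ (by omega)
  have arm := fun p h0 hp => armNbr_family5 k p h0 hp hf hA
  have tab : ∀ p < 9 * k + 9, (p = 0 ∧ f p = 3 * k + 1 ∧ T p = {3 * k, 3 * k + 2, 3 * k + 2} ∧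
        (T p).map b = {true, false, false}) ∨
      (0 < p ∧ f p = 0 ∧ T p = {0, 1} ∧
        (T p).map b = {true, false}) ∨
      (0 < p ∧ (f p % 3 ≠ 0 ∧ f p ≤ 3 * k + 1) ∧ T p = {f p - 1, f p + 1, f p} ∧
        (T p).map b = {true, false, false}) ∨
      (0 < p ∧ (0 < f p ∧ f p % 3 = 0 ∧ f p ≤ 3 * k + 1) ∧ T p = {f p - 1, f p + 1} ∧
        (T p).map b = {false, false}) ∨
      (0 < p ∧ f p = 3 * k + 2 ∧ T p = {3 * k + 1, 3 * k + 3, 3 * k + 1} ∧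
        (T p).map b = {true, false, false}) ∨
      (0 < p ∧ f p = 3 * k + 3 ∧ T p = {3 * k + 2, 3 * k + 2} ∧
        (T p).map b = {false, false}) := by
    intro p hp
    rcases Nat.eq_zero_or_pos p with rfl | hp0
    · exact Or.inl ⟨rfl, hf0, hT₀, by
        rw [hT₀]; simp [hb0, hb2]⟩
    rcases arm p hp0 hp with
      ⟨hX, h1, h2⟩ | ⟨hX, h1, h1', h2⟩ | ⟨hX, h1, h1', h1'', h2⟩ | ⟨hX, h1, h2⟩ | ⟨hX, h1, h2⟩
    · have hTp := hT p hp0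
      rw [if_neg hX, h2, add_zero] at hTp
      exact Or.inr (Or.inl ⟨hp0, h1, hTp, by
        rw [hTp]; simp [hbt 0 rfl, hbf 1 (by norm_num)]⟩)
    · have hTp := hT p hp0
      rw [if_neg hX, h2, add_zero] at hTp
      exact Or.inr (Or.inr (Or.inl ⟨hp0, ⟨h1, h1'⟩, hTp, by
        rw [hTp]; rcases (by omega : f p % 3 = 1 ∨ f p % 3 = 2) with h3 | h3
        · simp [hbf (f p) h1, hbt (f p - 1) (by omega), hbf (f p + 1) (by omega)]
        · simp [hbf (f p) h1, hbf (f p - 1) (by omega), hbt (f p + 1) (by omega),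
            Multiset.cons_swap true]⟩))
    · have hTp := hT p hp0
      rw [if_neg hX, h2, add_zero] at hTp
      exact Or.inr (Or.inr (Or.inr (Or.inl ⟨hp0, ⟨h1, h1', h1''⟩, hTp, by
        rw [hTp]; simp [hbf (f p - 1) (by omega), hbf (f p + 1) (by omega)]⟩)))
    · have hTp := hT p hp0
      rw [if_pos hX, h2, Multiset.insert_eq_cons, Multiset.cons_add, Multiset.singleton_add] at hTp
      exact Or.inr (Or.inr (Or.inr (Or.inr (Or.inl ⟨hp0, h1, hTp, by
        rw [hTp]; simp [hb1, hb3] <;> decide⟩))))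
    · have hTp := hT p hp0
      rw [if_neg hX, h2, add_zero] at hTp
      exact Or.inr (Or.inr (Or.inr (Or.inr (Or.inr (⟨hp0, h1, hTp, by
        rw [hTp]; simp [hb2]⟩)))))
  -- The remaining values `3 * k + 2` and `3 * k + 3` differ in degree. Position 0 shares its value
  -- with positions of the other layers, so no prefix is isolated yet.
  refine h.isLongRefinement_of_fold (t := 1) (n := 3 * k + 2) (q₀ := 0) b f A T
    (length_family5 k) (by omega) (by omega) (by rw [hfr, hfr']) (fun p => by rw [hA])
    (by rw [hT₀, hf1, hfr]) (by rwa [hf0]) ?_ ?_ ?_ ?_ ?_ ?_ ?_ ?_ ?_ ?_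
  · refine Or.inr ⟨rfl, fun p q hp hq => ?_⟩
    have hcard : ∀ p < 9 * k + 9, (T p).card = if f p % 3 = 0 then 2 else 3 := by
      intro p hp
      rcases tab p hp with hp | hp | hp | hp | hp | hp <;>
      obtain ⟨hp0, hp1, hp2, hp3⟩ := hp <;>
      first
        | (rw [if_pos (by omega), hp2]; rfl)
        | (rw [if_neg (by omega), hp2]; rfl)
    rw [hcard p hp, hcard q hq, hb, hb, decide_eq_decide]
    split_ifs <;> simp_all
  · intro p q hp hq _ hpq
    rcases tab p hp with hp | hp | hp | hp | hp | hp <;>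
    rcases tab q hq with hq | hq | hq | hq | hq | hq <;>
    obtain ⟨hp0, hp1, hp2, hp3⟩ := hp <;>
    obtain ⟨hq0, hq1, hq2, hq3⟩ := hq <;>
    first
      | omega
      | (rw [hp2, hq2, hpq]; done)
      | (rw [hp2, hq2] <;> simp [hpq, hq1, hb0, hb2, hb1, hb3]; done)
      | (rw [hp2, hq2] <;> simp [← hpq, hp1, hb0, hb2, hb1, hb3])
  · intro p q hp hq h0 hpq hbpq
    rw [hb, hb, decide_eq_decide] at hbpq
    rcases tab p hp with hp | hp | hp | hp | hp | hp <;>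
    rcases tab q hq with hq | hq | hq | hq | hq | hq <;>
    obtain ⟨hp0, hp1, hp2, hp3⟩ := hp <;>
    obtain ⟨hq0, hq1, hq2, hq3⟩ := hq <;>
    first
      | omega
      | (rw [hp3, hq3, hp2, hq2]; simp [Multiset.count_cons, Multiset.count_singleton] <;>
          first | omega | (split_ifs <;> omega))
  · intro p q hp hq h0 hpq hbpq
    rw [hb, hb, decide_eq_decide] at hbpq
    rcases tab p hp with hp | hp | hp | hp | hp | hp <;>
    rcases tab q hq with hq | hq | hq | hq | hq | hq <;>
    obtain ⟨hp0, hp1, hp2, hp3⟩ := hp <;>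
    obtain ⟨hq0, hq1, hq2, hq3⟩ := hq <;>
    first | omega | (rw [hp3, hq3]; decide)
  · intro p q hp hq hn hpq hbpq
    rw [hb, hb, decide_eq_decide] at hbpq
    rcases tab q hq with hq | hq | hq | hq | hq | hq <;>
    obtain ⟨hq0, hq1, hq2, hq3⟩ := hq <;>
    omega
  · intro p q hp
    omega
  · intro p q hp hpq hq hf
    rcases arm p (by omega) (by omega) with
      ⟨hX, h1, h2⟩ | ⟨hX, h1, h1', h2⟩ | ⟨hX, h1, h1', h1'', h2⟩ | ⟨hX, h1, h2⟩ | ⟨hX, h1, h2⟩ <;>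
    rcases arm q (by omega) hq with
      ⟨hX', h3, h4⟩ | ⟨hX', h3, h3', h4⟩ | ⟨hX', h3, h3', h3'', h4⟩ | ⟨hX', h3, h4⟩ |
        ⟨hX', h3, h4⟩ <;>
    first
      | omega
      | exact ⟨by rw [h2, h4, hf], by tauto⟩
      | exact ⟨by rw [h2, h4], by tauto⟩
  · omega
  · intro _ p h0 hpl hf heq
    rw [hT₀] at heq
    have hc := congrArg (Multiset.count (3 * k + 2)) heq
    rcases tab p hpl with hp | hp | hp | hp | hp | hp <;>
    obtain ⟨hp0, hp1, hp2, hp3⟩ := hp <;>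
    first
      | omega
      | (rw [hp2] at hc; simp [← hf, hf0] at hc)
  · intro p q hp hpq hq
    simp only [hfold, fold]
    split_ifs <;> omega

/-! ### The exceptional string -/

theorem layout_S011XX : Layout [S, zero, one, one, X, X] 4 5 (fun p => p = 2 ∨ p = 3) :=
  Layout.of_getElem? (by omega) (by omega) (by decide) (by omega) (by omega) (by decide)

theorem isLongRefinement_S011XX : IsLongRefinement (encodedGraph [S, zero, one, one, X, X]) := by
  have h := layout_S011XX
  -- This is no three-layer fold: `f` only records the order of separation. Value 3 marks the single
  -- pair of degree 2, set apart by the degree round; round 0 separates positions 3, 4, 5, which do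
  -- not see it, from 0 and 2, and round 1 separates 2 from 0.
  obtain ⟨f, hf⟩ : ∃ f : ℕ → ℕ, f = fun p =>
    if p = 0 then 2 else if p = 1 then 3 else if p = 2 then 1 else 0 := ⟨_, rfl⟩
  obtain ⟨A, hA⟩ : ∃ A : ℕ → Multiset ℕ,
    A = fun p => (armNbr 6 (fun p => p = 2 ∨ p = 3) p).map f := ⟨_, rfl⟩
  obtain ⟨T, hT₀, hT⟩ : ∃ T : ℕ → Multiset ℕ, T 0 = {f 1, f 4, f 4} ∧
      ∀ p, 0 < p → T p = A p + (if p = 4 ∨ p = 5 then {f 0} else 0) :=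
    ⟨fun p => if p = 0 then _ else _, if_pos rfl, fun p hp => if_neg hp.ne'⟩
  have hf0 : f 0 = 2 := by rw [hf]; rfl
  have hf1 : f 1 = 3 := by rw [hf]; rfl
  have hf2 : f 2 = 1 := by rw [hf]; rfl
  have hf3 : f 3 = 0 := by rw [hf]; rfl
  have hf4 : f 4 = 0 := by rw [hf]; rfl
  have hf5 : f 5 = 0 := by rw [hf]; rfl
  have hA4 : A 4 = {0, 0} := by simp [hA, armNbr, hf3, hf5]
  have hA5 : A 5 = {0, 0} := by simp [hA, armNbr, hf4, hf5]
  have hT0 : T 0 = {3, 0, 0} := by rw [hT₀, hf1, hf4]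
  have hT1 : T 1 = {2, 1} := by simp [hT, hA, armNbr, hf0, hf2]
  have hT2 : T 2 = {3, 0, 1} := by simp [hT, hA, armNbr, hf1, hf2, hf3]
  have hT3 : T 3 = {0, 0, 1} := by
    simp [hT, hA, armNbr, hf2, hf3, hf4]
    decide
  have hT4 : T 4 = {0, 0, 2} := by rw [hT 4 (by omega), hA4, if_pos (by omega), hf0]; rfl
  have hT5 : T 5 = {0, 0, 2} := by rw [hT 5 (by omega), hA5, if_pos (by omega), hf0]; rfl
  refine h.isLongRefinement_of_fold (t := 1) (n := 2) (q₀ := 3) (l := 6) (fun i => i = 3) f A T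
    rfl (by omega) (by omega) (by rw [hf4, hf5]) (fun p => by rw [hA]) hT₀ hT
    (Or.inr ⟨rfl, ?_⟩) ?_ ?_ ?_ ?_ ?_ ?_ ?_ ?_ ?_
  all_goals clear hT hT₀ hf hA
  · intro p q hp hq
    interval_cases q <;> interval_cases p <;> simp [*]
  · intro p q hp hq hpq
    interval_cases q <;> interval_cases p <;> simp [*]
  · intro p q hp hq h0 hpq
    interval_cases q <;> interval_cases p <;> first | omega | simp [*]
  · intro p q hp hq h0 hpq
    interval_cases q <;> interval_cases p <;> first | omega | simp [*]
  · intro p q hp hq hn hpq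
    interval_cases q <;> interval_cases p <;> first | omega | simp [*]
  · intro p q hp hq
    interval_cases q <;> interval_cases p <;> omega
  · intro p q hp hpq hq
    interval_cases q <;> interval_cases p <;> simp [*]
  · omega
  · omega
  · intro p q hp hpq hq
    omega

/-! ### Admissibility, degrees and conclusion -/

theorem isAdmissible_of_longRefinementStrings {Ξ : List Letter} (h : Ξ ∈ longRefinementStrings) :
    IsAdmissible Ξ := by
  rcases h with ((((rfl | ⟨k, rfl⟩) | ⟨k, rfl⟩) | ⟨k, rfl⟩) | ⟨k, rfl⟩) | ⟨k, rfl⟩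
  · exact ⟨by decide, rfl, by decide⟩
  · exact ⟨by rw [length_family1]; omega, rfl, by simp [family1, count_rep]⟩
  · exact ⟨by rw [length_family2]; omega, rfl, by simp [family2, count_rep]⟩
  · exact ⟨by rw [length_family3]; omega, rfl, by simp [family3, count_rep]⟩
  · exact ⟨by rw [length_family4]; omega, rfl, by simp [family4, count_rep]⟩
  · exact ⟨by rw [length_family5]; omega, rfl, by simp [family5, count_rep]⟩

theorem Layout.range_degree_of_fold {Ξ : List Letter} {z m c l r r' : ℕ}
    (h : Layout Ξ r r' (OnesOf z (fold m c l) r r')) (hm : 0 < m) (hr : m < r) :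
    Set.range (fun v => (encodedGraph Ξ).degree v) = {2, 3} := by
  have hlt := h.lt
  have hl := h.lt_length
  -- The crease `m` has folded value 0, hence no letter 1, and supplies the degree 2.
  exact h.range_degree ⟨m, hm, by omega, fun hL => hL.1 (by rw [fold_of_le le_rfl]; simp),
    by omega, by omega⟩

end ColourRefinement

open ColourRefinement in
/-- Every listed string is admissible and encodes a long-refinement graph whose set of vertex
degrees is `{2, 3}`. -/
theorem mainTheorem3 :
    ∀ Ξ ∈ ColourRefinement.longRefinementStrings,
      ColourRefinement.IsAdmissible Ξ ∧
      Set.range (fun v => (ColourRefinement.encodedGraph Ξ).degree v) = {2, 3} ∧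
      ColourRefinement.IsLongRefinement (ColourRefinement.encodedGraph Ξ) := by
  intro Ξ hΞ
  refine ⟨isAdmissible_of_longRefinementStrings hΞ, ?_⟩
  rcases hΞ with ((((rfl | ⟨k, rfl⟩) | ⟨k, rfl⟩) | ⟨k, rfl⟩) | ⟨k, rfl⟩) | ⟨k, rfl⟩
  · exact ⟨layout_S011XX.range_degree ⟨1, by decide⟩, isLongRefinement_S011XX⟩
  · exact ⟨(layout_family1 k).range_degree_of_fold (by omega) (by omega),
      isLongRefinement_family1 k⟩
  · exact ⟨(layout_family2 k).range_degree_of_fold (by omega) (by omega),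
      isLongRefinement_family2 k⟩
  · exact ⟨(layout_family3 k).range_degree_of_fold (by omega) (by omega),
      isLongRefinement_family3 k⟩
  · exact ⟨(layout_family4 k).range_degree_of_fold (by omega) (by omega),
      isLongRefinement_family4 k⟩
  · exact ⟨(layout_family5 k).range_degree_of_fold (by omega) (by omega),
      isLongRefinement_family5 k⟩
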